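/- Let $r\ge 1$ be an integer (not necessarily prime), let $PU(r)=SU(r)/Z(SU(r))$, where the center $Z(SU(r))\cong\mathbb{Z}/r$ consists of the scalar matrices $\lambda I$ with $\lambda^r=1$, and let $\operatorname{Hom}(\mathbb{Z}^2,PU(r))$ carry the topology of the space of commuting pairs in $PU(r)\times PU(r)$. Let $H\subset PU(r)$ be the subgroup generated by the classes of the clock matrix $\operatorname{diag}(1,\zeta,\dots,\zeta^{r-1})$, $\zeta=e^{2\pi i/r}$, and of the shift matrix (the permutation matrix of an $r$-cycle $i\mapsto i+1 \bmod r$), both multiplied by a scalar so as to have determinant $1$. Then $\operatorname{Hom}(\mathbb{Z}^2,PU(r))$ has exactly $r$ path components. The group $H$ is isomorphic to $(\mathbb{Z}/r)^2$, and exactly $\varphi(r)$ of the path components (Euler's $\varphi$) are homeomorphic to the coset space $PU(r)/H=PU(r)/(\mathbb{Z}/r)^2$. These are precisely the components where the commutator of lifts generates the center: if $f\in\operatorname{Hom}(\mathbb{Z}^2,PU(r))$ and $x,y\in SU(r)$ are any lifts of the images under $f$ of the two standard generators of $\mathbb{Z}^2$, then the path component of $f$ is homeomorphic to $PU(r)/H$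 if and only if $[x,y]$ generates $Z(SU(r))$. -/

import Mathlib

open scoped Matrix Nat commutatorElement

noncomputable section

/-- The set of homomorphisms from `ℤⁿ` (written multiplicatively) to a group `G`. -/
def HomZ (n : ℕ) (G : Type) [Group G] : Type :=
  Multiplicative (Fin n → ℤ) →* G

namespace HomZ

variable {n : ℕ} {G : Type} [Group G]

/-- The value of a homomorphism `ℤⁿ → G` at the `i`-th standard generator of `ℤⁿ`. -/
def gen (f : HomZ n G) (i : Fin n) : G :=
  (show Multiplicative (Fin n → ℤ) →* G from f) (Multiplicative.ofAdd (Pi.single i 1))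

/-- `Hom(ℤⁿ, G)`, identified with the commuting `n`-tuples of `G` by the values on the generators,
has the subspace topology from the product `Gⁿ`. -/
instance [TopologicalSpace G] : TopologicalSpace (HomZ n G) :=
  TopologicalSpace.induced gen inferInstance

end HomZ

/-- The special unitary group `SU(r)`. -/
abbrev SU (r : ℕ) : Type := Matrix.specialUnitaryGroup (Fin r) ℂ

/-- The projective unitary group `PU(r) = SU(r)/Z(SU(r))`, with the quotient topology. -/
abbrev PU (r : ℕ) : Type := SU r ⧸ Subgroup.center (SU r)

namespace PU

/-- The `k`-th diagonal entry `e^{πi(r-1)/r} e^{2πik/r}` of the normalized clock matrix. -/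
def phase (r : ℕ) (k : ℝ) : ℂ :=
  Complex.exp (((Real.pi * ((r : ℝ) - 1) / r + 2 * Real.pi * k / r : ℝ) : ℂ) * Complex.I)

/-- The clock matrix `diag(1, ζ, …, ζ^{r-1})`, with `ζ = e^{2πi/r}`, times the scalar
`e^{πi(r-1)/r}` that makes its determinant `1`. -/
def clockMatrix (r : ℕ) : Matrix (Fin r) (Fin r) ℂ :=
  Matrix.diagonal fun k => phase r (k : ℕ)

/-- The shift matrix (the permutation matrix of an `r`-cycle) times the scalar
`e^{πi(r-1)/r}` that makes its determinant `1`. -/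
def shiftMatrix (r : ℕ) : Matrix (Fin r) (Fin r) ℂ :=
  phase r 0 • (finRotate r).permMatrix ℂ

theorem star_phase_mul (r : ℕ) (k : ℝ) : star (phase r k) * phase r k = 1 := by
  rw [Complex.star_def, ← Complex.normSq_eq_conj_mul_self, Complex.normSq_eq_norm_sq]
  unfold phase
  rw [Complex.norm_exp_ofReal_mul_I]
  simp

theorem clockMatrix_mem (r : ℕ) : clockMatrix r ∈ Matrix.specialUnitaryGroup (Fin r) ℂ := by
  rw [Matrix.mem_specialUnitaryGroup_iff, Matrix.mem_unitaryGroup_iff']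
  constructor
  · rw [clockMatrix, Matrix.star_eq_conjTranspose, Matrix.diagonal_conjTranspose,
      Matrix.diagonal_mul_diagonal, ← Matrix.diagonal_one]
    congr 1
    funext k
    exact star_phase_mul r _
  · rw [clockMatrix, Matrix.det_diagonal]
    rcases Nat.eq_zero_or_pos r with rfl | hr
    · simp
    · have hr' : (r : ℝ) ≠ 0 := by positivity
      unfold phase
      rw [← Complex.exp_sum, Complex.exp_eq_one_iff]
      refine ⟨(r : ℤ) - 1, ?_⟩
      have h2 : (∑ k : Fin r, ((k : ℕ) : ℝ)) = (r : ℝ) * (r - 1) / 2 := by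
        rw [Fin.sum_univ_eq_sum_range (fun k => (k : ℝ)) r]
        clear hr hr'
        induction r with
        | zero => simp
        | succ n ih => rw [Finset.sum_range_succ, ih]; push_cast; ring
      have h : (∑ k : Fin r, (Real.pi * ((r : ℝ) - 1) / r + 2 * Real.pi * (k : ℕ) / r))
          = ((r : ℝ) - 1) * (2 * Real.pi) := by
        rw [Finset.sum_add_distrib, ← Finset.sum_div, ← Finset.sum_div, ← Finset.mul_sum,
          ← Finset.mul_sum, h2]
        simp only [Finset.sum_const, Finset.card_univ, Fintype.card_fin, nsmul_eq_mul]
        field_simp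
        ring
      rw [← Finset.sum_mul, ← Complex.ofReal_sum, h]
      push_cast
      ring

theorem shiftMatrix_mem (r : ℕ) : shiftMatrix r ∈ Matrix.specialUnitaryGroup (Fin r) ℂ := by
  rw [Matrix.mem_specialUnitaryGroup_iff, Matrix.mem_unitaryGroup_iff']
  constructor
  · rw [shiftMatrix, Matrix.star_eq_conjTranspose, Matrix.conjTranspose_smul,
      Matrix.conjTranspose_permMatrix, Matrix.smul_mul, Matrix.mul_smul, smul_smul,
      ← Matrix.permMatrix_mul, star_phase_mul]
    simp
  · rw [shiftMatrix, Matrix.det_smul, Matrix.det_permutation, sign_finRotate, Fintype.card_fin]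
    rcases Nat.eq_zero_or_pos r with rfl | hr
    · simp
    · obtain ⟨n, rfl⟩ : ∃ n, r = n + 1 := ⟨r - 1, by omega⟩
      have h : phase (n + 1) 0 ^ (n + 1) = (-1) ^ n := by
        unfold phase
        rw [← Complex.exp_nat_mul, ← Complex.exp_pi_mul_I, ← Complex.exp_nat_mul]
        congr 1
        push_cast
        have : (n : ℂ) + 1 ≠ 0 := by exact_mod_cast Nat.succ_ne_zero n
        field_simp
        ring
      rw [h]
      simp [← mul_pow]

/-- The subgroup of `PU(r)` generated by the classes of the clock and shift matrices. It is
isomorphic to `(ℤ/r)²` and is unique up to conjugation among the subgroups of `PU(r)` that are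
generated by two elements whose lifts to `SU(r)` have a commutator generating the center. -/
def clockShift (r : ℕ) : Subgroup (PU r) :=
  Subgroup.closure
    {QuotientGroup.mk (⟨clockMatrix r, clockMatrix_mem r⟩ : SU r),
      QuotientGroup.mk (⟨shiftMatrix r, shiftMatrix_mem r⟩ : SU r)}

end PU

end

/-!
A pair of elements of `PU(r)` commutes exactly when the commutator `ω` of lifts to `SU(r)` is
central, and `ω` does not depend on the lifts. The map `PU.comm`, `f ↦ ω`, is continuous with values
in the finite center, so it is constant on path components.

*The fibers of `PU.comm` are connected.* If `ω = ζ I` with `ζ` of order `d` and `r = m d`, then two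
unitary matrices `x`, `y` with `x y = ζ y x` are simultaneously unitarily conjugate to `m` blocks
of the form (multiple of the `d × d` clock matrix, multiple of the `d × d` shift matrix): the orbit
under `y` of a common eigenvector of `x` and `y ^ d` spans one block, and its orthogonal complement
is again invariant (`IsTwistedPair.exists_family`, `Block.exists_conj`). Hence the fiber over `ω` is
the image of `PU(r)` times two copies of a torus of dimension `m - 1`
(`PU.BlockModel.range_param`), and it is path connected and nonempty. So the path components are
the fibers over the `r` central elements (`PU.range_pathComponent`).

*Generators of the center.* If `ω` has order `r`, then `m = 1`, there is no torus, and the fiber is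
a single conjugation orbit of `PU(r)`. The stabilizer of the pair (power of the clock matrix, shift
matrix) is the subgroup `H` generated by the clock and shift matrices, since a matrix that commutes
with both up to scalars can be corrected by clock and shift matrices until it commutes with both,
and is then scalar (`IsHeisenbergPair.commute_mk_pow_iff`). The orbit map is a homeomorphism from
`PU(r)/H` by compactness (`PU.nonempty_homeomorph_of_orderOf_eq`).

*Other central elements.* If `ω` has order less than `r`, then `m ≥ 2`. Near a generic pair in the
fiber, conjugation moves the pair in `r² - m` independent directions, and the two tori in
`2 (m - 1)` further ones, so the fiber contains an injective continuous image of an open set of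
dimension `r² + m - 2 > r² - 1` (`PU.BlockModel.exists_injOn_fiber`). On the other hand
`PU(r)/H` is locally embedded in the space of traceless skew-Hermitian matrices, of dimension
`r² - 1` (`PU.finrank_le_of_injOn_quotient`). Invariance of dimension excludes a homeomorphism.

*Invariance of dimension* (`not_injOn_nhds_of_finrank_lt`) follows from the nonexistence of a
continuously differentiable retraction of the ball onto the sphere, which is proved by an integral:
the volume of the image of the ball under `x ↦ x + t (ρ x - x)` is polynomial in `t`, constant for
small `t`, and zero at `t = 1`. A continuous injection into a space of smaller dimension would have
a continuous inverse, which extends to the whole space and can be perturbed to a smooth map; the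
image of this map has dense complement, and this contradicts the existence of zeros of maps close
to the identity.
-/

/-! ### Invariance of dimension -/

section InvarianceOfDimension

open Set Metric Topology MeasureTheory Module

/-- `t ↦ det (1 + t A)` is given by a polynomial of degree at most `dim E`. -/
theorem LinearMap.exists_polynomial_det_one_add_smul {E : Type*} [AddCommGroup E] [Module ℝ E]
    [FiniteDimensional ℝ E] (A : E →ₗ[ℝ] E) :
    ∃ p : Polynomial ℝ, p.natDegree ≤ finrank ℝ E ∧
      ∀ t : ℝ, p.eval t = LinearMap.det (1 + t • A) := by
  classical
  let b := finBasis ℝ E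
  let M := LinearMap.toMatrix b b A
  refine ⟨((Polynomial.X : Polynomial ℝ) • M.map Polynomial.C
    + (1 : Matrix (Fin (finrank ℝ E)) (Fin (finrank ℝ E)) ℝ).map Polynomial.C).det, ?_, ?_⟩
  · simpa using Polynomial.natDegree_det_X_add_C_le M 1
  · intro t
    rw [← LinearMap.det_toMatrix b, ← Polynomial.coe_evalRingHom, RingHom.map_det]
    congr 1
    ext i j
    simp only [Polynomial.coe_evalRingHom, RingHom.mapMatrix_apply, Matrix.map_apply,
      Matrix.add_apply, Matrix.smul_apply, smul_eq_mul, Polynomial.eval_mul,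
      Polynomial.eval_X, Polynomial.eval_C, map_add, map_smul, LinearMap.toMatrix_one, M]
    rw [add_comm]

/-- The determinant of `1 + t A` cannot vanish for `t ‖A‖ < 1`, so it keeps the sign it has at
`t = 0`. -/
theorem LinearMap.det_one_add_smul_pos {E : Type*} [NormedAddCommGroup E] [NormedSpace ℝ E]
    [FiniteDimensional ℝ E] (A : E →L[ℝ] E) {t K : ℝ} (ht : 0 ≤ t) (hA : ‖A‖ ≤ K)
    (htK : t * K < 1) : 0 < LinearMap.det (1 + t • (A : E →ₗ[ℝ] E)) := by
  obtain ⟨p, -, hp⟩ := LinearMap.exists_polynomial_det_one_add_smul (A : E →ₗ[ℝ] E)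
  have hK : 0 ≤ K := (norm_nonneg A).trans hA
  have hne : ∀ s ∈ Icc 0 t, p.eval s ≠ 0 := by
    intro s hs h0
    rw [hp] at h0
    have hker := LinearMap.bot_lt_ker_of_det_eq_zero h0
    obtain ⟨v, hv, hv0⟩ := (Submodule.ne_bot_iff _).1 hker.ne'
    have h1 : v + s • A v = 0 := by simpa using hv
    have h2 : ‖v‖ = s * ‖A v‖ := by
      have := congrArg norm (eq_neg_of_add_eq_zero_left h1)
      rwa [norm_neg, norm_smul, Real.norm_of_nonneg hs.1] at this
    have h3 : ‖A v‖ ≤ K * ‖v‖ := A.le_of_opNorm_le hA v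
    have h4 : 0 < ‖v‖ := norm_pos_iff.2 hv0
    nlinarith [mul_le_mul_of_nonneg_left h3 hs.1, mul_le_mul_of_nonneg_right hs.2 hK]
  rw [← hp]
  by_contra! hneg
  have h0 : p.eval 0 = 1 := by rw [hp]; simp
  obtain ⟨s, hs, hs0⟩ := intermediate_value_Icc' ht p.continuous.continuousOn
    (show (0 : ℝ) ∈ Icc (p.eval t) (p.eval 0) by rw [h0]; exact ⟨hneg, zero_le_one⟩)
  exact hne s hs hs0

variable {E : Type} [NormedAddCommGroup E] [InnerProductSpace ℝ E] [FiniteDimensional ℝ E]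

/-- A self-map of the closed unit ball that fixes the sphere pointwise and is close to the identity
maps the open ball onto itself: the image is open and is closed in the ball. -/
theorem image_ball_eq_of_approximatesLinearOn {f : E → E} {c : NNReal} (hc : c < 1)
    (hf : ApproximatesLinearOn f (ContinuousLinearMap.id ℝ E) (closedBall 0 1) c)
    (hball : ∀ x, ‖x‖ < 1 → ‖f x‖ < 1) (hsphere : ∀ x, ‖x‖ = 1 → f x = x) :
    f '' ball 0 1 = ball 0 1 := by
  have hmaps : f '' ball 0 1 ⊆ ball 0 1 := by
    rintro _ ⟨x, hx, rfl⟩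
    exact mem_ball_zero_iff.2 (hball x (mem_ball_zero_iff.1 hx))
  have hopen : IsOpen (f '' ball 0 1) :=
    (hf.mono_set ball_subset_closedBall).open_image
      ⟨id, 1, fun y => by simp, fun y => rfl⟩ isOpen_ball (Or.inr (by simpa using hc))
  have hcl : closure (f '' ball 0 1) ∩ ball 0 1 ⊆ f '' ball 0 1 := by
    rintro y ⟨hy, hy1⟩
    have hcomp : IsCompact (f '' closedBall 0 1) :=
      (isCompact_closedBall 0 1).image_of_continuousOn hf.continuousOn
    obtain ⟨x, hx, rfl⟩ :=
      closure_minimal (image_mono ball_subset_closedBall) hcomp.isClosed hy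
    refine ⟨x, ?_, rfl⟩
    rw [mem_closedBall_zero_iff] at hx
    rw [mem_ball_zero_iff] at hy1 ⊢
    refine lt_of_le_of_ne hx fun h => ?_
    rw [hsphere x h] at hy1
    exact hy1.ne h
  refine hmaps.antisymm (((convex_ball (0 : E) 1).isPreconnected).subset_of_closure_inter_subset
    hopen ⟨f 0, ?_, mem_image_of_mem f (mem_ball_self one_pos)⟩ hcl)
  exact mem_ball_zero_iff.2 (hball 0 (by simp))

/-- There is no continuously differentiable retraction onto the unit sphere. The volume of the
image of the ball under `x ↦ x + t (r x - x)` is the integral of a polynomial in `t`; it is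
constant for small `t`, hence for `t = 1`, where the integrand vanishes. -/
theorem not_exists_contDiff_retraction_sphere {r : E → E} (hr : ContDiff ℝ 1 r)
    (hr1 : ∀ x, ‖r x‖ = 1) (hrs : ∀ x, ‖x‖ = 1 → r x = x) : False := by
  classical
  borelize E
  let μ : Measure E := Measure.addHaar
  set g : E → E := fun x => r x - x with hg
  have hgc : ContDiff ℝ 1 g := hr.sub contDiff_id
  have hgd : Differentiable ℝ g := hgc.differentiable one_ne_zero
  have hgf : Continuous (fderiv ℝ g) := hgc.continuous_fderiv one_ne_zero
  obtain ⟨K₀, hK₀⟩ := (isCompact_closedBall (0 : E) 1).exists_bound_of_continuousOn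
    hgf.continuousOn
  set K : NNReal := Real.toNNReal K₀ + 1 with hKdef
  have hK : ∀ x ∈ closedBall (0 : E) 1, ‖fderiv ℝ g x‖ ≤ K := fun x hx => by
    have h1 := Real.le_coe_toNNReal K₀
    have h2 := hK₀ x hx
    rw [hKdef]; push_cast; linarith
  have hKpos : (0 : ℝ) < K := by rw [hKdef]; push_cast; positivity
  have hlip : LipschitzOnWith K g (closedBall 0 1) :=
    (convex_closedBall (0 : E) 1).lipschitzOnWith_of_nnnorm_fderiv_le (𝕜 := ℝ)
      (fun x _ => hgd x) (fun x hx => by exact_mod_cast hK x hx)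
  -- the volume of the image is constant for small `t`
  have hvol : ∀ t : ℝ, 0 ≤ t → t * K < 1 → t < 1 →
      ∫ x in ball (0 : E) 1, LinearMap.det (1 + t • (fderiv ℝ g x : E →ₗ[ℝ] E)) ∂μ
        = μ.real (ball 0 1) := by
    intro t ht htK ht1
    set f : E → E := fun x => x + t • g x with hf
    have hder : ∀ x, HasFDerivAt f (ContinuousLinearMap.id ℝ E + t • fderiv ℝ g x) x := fun x =>
      (hasFDerivAt_id x).add ((hgd x).hasFDerivAt.const_smul t)
    have happ : ApproximatesLinearOn f (ContinuousLinearMap.id ℝ E) (closedBall 0 1)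
        (Real.toNNReal t * K) := by
      rw [ApproximatesLinearOn.approximatesLinearOn_iff_lipschitzOnWith]
      have : f - ⇑(ContinuousLinearMap.id ℝ E) = fun x => t • g x := by
        ext x; simp [hf]
      rw [this]
      intro x hx y hy
      have h := hlip hx hy
      rw [edist_smul₀, ENNReal.coe_mul, mul_assoc]
      have : ‖t‖₊ = Real.toNNReal t := by
        rw [Real.toNNReal_of_nonneg ht]; ext; simp [abs_of_nonneg ht]
      rw [this, ENNReal.smul_def, smul_eq_mul]
      gcongr
    have hc : Real.toNNReal t * K < 1 := by
      rw [← NNReal.coe_lt_coe]; push_cast; rwa [Real.coe_toNNReal t ht]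
    have himg : f '' ball 0 1 = ball 0 1 := by
      apply image_ball_eq_of_approximatesLinearOn hc happ
      · intro x hx
        have : f x = (1 - t) • x + t • r x := by simp only [hf, hg]; module
        rw [this]
        calc ‖(1 - t) • x + t • r x‖ ≤ ‖(1 - t) • x‖ + ‖t • r x‖ := norm_add_le _ _
          _ = (1 - t) * ‖x‖ + t := by
            rw [norm_smul, norm_smul, hr1, Real.norm_of_nonneg ht, Real.norm_of_nonneg (by linarith),
              mul_one]
          _ < 1 := by nlinarith
      · intro x hx
        simp [hf, hg, hrs x hx]
    have hinj : InjOn f (ball 0 1) := by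
      intro x hx y hy hxy
      have h := happ x (ball_subset_closedBall hx) y (ball_subset_closedBall hy)
      rw [hxy, sub_self, zero_sub, norm_neg, ContinuousLinearMap.id_apply] at h
      by_contra hne
      have h1 : 0 < ‖x - y‖ := norm_pos_iff.2 (sub_ne_zero.2 hne)
      have h2 : ((Real.toNNReal t * K : NNReal) : ℝ) < 1 := by exact_mod_cast hc
      nlinarith
    have key := integral_image_eq_integral_abs_det_fderiv_smul μ measurableSet_ball
      (fun x _ => (hder x).hasFDerivWithinAt) hinj (fun _ => (1 : ℝ))
    rw [himg] at key
    simp only [integral_const, smul_eq_mul, mul_one, measureReal_restrict_apply_univ] at key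
    rw [key]
    refine setIntegral_congr_fun measurableSet_ball fun x hx => ?_
    have hpos := LinearMap.det_one_add_smul_pos (fderiv ℝ g x) ht
      (hK x (ball_subset_closedBall hx)) htK
    have : (ContinuousLinearMap.id ℝ E + t • fderiv ℝ g x).det
        = LinearMap.det (1 + t • (fderiv ℝ g x : E →ₗ[ℝ] E)) := rfl
    simp only [this, abs_of_pos hpos]
  -- interpolate the polynomial `t ↦ det (1 + t Dg)` at `n + 1` nodes that are small enough for
  -- `hvol`, with the same coefficients for all points of the ball
  let n := finrank ℝ E
  let v : ℕ → ℝ := fun i => (1 / (K + 1)) * (1 / (i + 2))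
  have hvpos : ∀ i, 0 < v i := fun i => by positivity
  have hvle : ∀ i, v i ≤ 1 / (K + 1) * (1 / 2) := fun i => by
    apply mul_le_mul_of_nonneg_left _ (by positivity)
    apply one_div_le_one_div_of_le two_pos
    have : (0 : ℝ) ≤ i := by positivity
    linarith
  have hvK : ∀ i, v i * K < 1 := fun i => by
    calc v i * K ≤ 1 / (K + 1) * (1 / 2) * K := by gcongr; exact hvle i
      _ < 1 := by rw [one_div_mul_one_div, one_div_mul_eq_div, div_lt_one (by positivity)]; linarith
  have hv1 : ∀ i, v i < 1 := fun i => by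
    refine (hvle i).trans_lt ?_
    rw [one_div_mul_one_div, div_lt_one (by positivity)]; linarith
  have hvinj : InjOn v (Finset.range (n + 1) : Finset ℕ) := by
    intro i _ j _ hij
    have hK1 : (1 / ((K : ℝ) + 1)) ≠ 0 := by positivity
    have h := mul_left_cancel₀ hK1 hij
    rw [one_div, one_div, inv_inj, add_left_inj] at h
    exact_mod_cast h
  let L : ℕ → ℝ := fun i => (Lagrange.basis (Finset.range (n + 1)) v i).eval 1
  have hL : ∑ i ∈ Finset.range (n + 1), L i = 1 := by
    have := congrArg (Polynomial.eval 1) (Lagrange.sum_basis hvinj (by simp))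
    simpa [Polynomial.eval_finsetSum] using this
  have hdet : ∀ x, LinearMap.det (1 + (1 : ℝ) • (fderiv ℝ g x : E →ₗ[ℝ] E)) =
      ∑ i ∈ Finset.range (n + 1),
        LinearMap.det (1 + v i • (fderiv ℝ g x : E →ₗ[ℝ] E)) * L i := by
    intro x
    obtain ⟨p, hp, hpe⟩ := LinearMap.exists_polynomial_det_one_add_smul
      (fderiv ℝ g x : E →ₗ[ℝ] E)
    have hpd : p.degree < (Finset.range (n + 1)).card := by
      rw [Finset.card_range]
      exact (Polynomial.degree_le_of_natDegree_le hp).trans_lt (by exact_mod_cast Nat.lt_succ_self _)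
    have h := congrArg (Polynomial.eval 1) (Lagrange.eq_interpolate hvinj hpd)
    rw [Lagrange.interpolate_apply, Polynomial.eval_finsetSum] at h
    simpa [hpe, L] using h
  -- at `t = 1` the derivative is that of `r`, whose range is orthogonal to `r x`
  have hzero : ∀ x, LinearMap.det (1 + (1 : ℝ) • (fderiv ℝ g x : E →ₗ[ℝ] E)) = 0 := by
    intro x
    have hrd : HasFDerivAt r (fderiv ℝ r x) x := (hr.differentiable one_ne_zero x).hasFDerivAt
    have h1 : fderiv ℝ g x = fderiv ℝ r x - ContinuousLinearMap.id ℝ E :=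
      (hrd.sub (hasFDerivAt_id x)).fderiv
    have h2 : (1 + (1 : ℝ) • (fderiv ℝ g x : E →ₗ[ℝ] E)) = (fderiv ℝ r x : E →ₗ[ℝ] E) := by
      ext w; simp [h1]
    rw [h2]
    by_contra hne
    have hsurj : Function.Surjective (fderiv ℝ r x : E →ₗ[ℝ] E) :=
      ((LinearMap.equivOfDetNeZero _ hne).surjective)
    have hconst : HasFDerivAt (fun y => inner ℝ (r y) (r y)) (0 : E →L[ℝ] ℝ) x := by
      have : (fun y => inner ℝ (r y) (r y)) = fun _ => (1 : ℝ) := by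
        ext y; rw [real_inner_self_eq_norm_sq, hr1]; norm_num
      rw [this]; exact hasFDerivAt_const _ _
    have horth : ∀ w, inner ℝ (r x) (fderiv ℝ r x w) = 0 := by
      intro w
      have := congrArg (fun T : E →L[ℝ] ℝ => T w) ((hrd.inner ℝ hrd).unique hconst)
      simp [fderivInnerCLM_apply, real_inner_comm] at this
      simpa [real_inner_comm] using this
    obtain ⟨w, hw⟩ := hsurj (r x)
    have := horth w
    rw [show fderiv ℝ r x w = r x from hw, real_inner_self_eq_norm_sq, hr1] at this
    norm_num at this
  have hcont : ∀ i, IntegrableOn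
      (fun x => LinearMap.det (1 + v i • (fderiv ℝ g x : E →ₗ[ℝ] E)) * L i) (ball 0 1) μ := by
    intro i
    have hc : Continuous
        (fun x => (ContinuousLinearMap.id ℝ E + v i • fderiv ℝ g x).det * L i) :=
      (ContinuousLinearMap.continuous_det.comp
        (continuous_const.add (hgf.const_smul (v i)))).mul continuous_const
    exact (hc.continuousOn.integrableOn_compact (isCompact_closedBall (0 : E) 1)).mono_set
      ball_subset_closedBall
  have hfinal : (0 : ℝ) = μ.real (ball (0 : E) 1) := by
    calc (0 : ℝ) = ∫ x in ball (0 : E) 1,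
          LinearMap.det (1 + (1 : ℝ) • (fderiv ℝ g x : E →ₗ[ℝ] E)) ∂μ := by simp only [hzero]; simp
      _ = ∫ x in ball (0 : E) 1, ∑ i ∈ Finset.range (n + 1),
          LinearMap.det (1 + v i • (fderiv ℝ g x : E →ₗ[ℝ] E)) * L i ∂μ := by simp only [hdet]
      _ = ∑ i ∈ Finset.range (n + 1), μ.real (ball 0 1) * L i := by
        rw [integral_finsetSum _ fun i _ => hcont i]
        refine Finset.sum_congr rfl fun i _ => ?_
        rw [integral_mul_const, hvol (v i) (hvpos i).le (hvK i) (hv1 i)]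
      _ = μ.real (ball (0 : E) 1) := by rw [← Finset.mul_sum, hL, mul_one]
  have hpos : 0 < μ.real (ball (0 : E) 1) :=
    ENNReal.toReal_pos (measure_ball_pos μ 0 one_pos).ne' measure_ball_lt_top.ne
  exact hpos.ne hfinal

/-- A continuous map that moves the points of the unit ball by at most `1/2` has a zero there. -/
theorem exists_zero_of_norm_sub_le_half {f : E → E} (hf : Continuous f)
    (hfd : ∀ x, ‖x‖ ≤ 1 → ‖f x - x‖ ≤ 1 / 2) : ∃ x, ‖x‖ ≤ 1 ∧ f x = 0 := by
  by_contra! hne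
  -- damp `f` to the identity near the sphere
  let χ : E → ℝ := fun x => max 0 (min 1 (3 - 4 * ‖x‖))
  have hχc : Continuous χ := by fun_prop
  have hχ0 : ∀ x, 0 ≤ χ x := fun x => le_max_left _ _
  have hχ1 : ∀ x, χ x ≤ 1 := fun x => max_le zero_le_one (min_le_left _ _)
  have hχout : ∀ x, 3 / 4 ≤ ‖x‖ → χ x = 0 := fun x hx =>
    max_eq_left ((min_le_right _ _).trans (by linarith))
  have hχin : ∀ x, ‖x‖ ≤ 1 / 2 → χ x = 1 := fun x hx => by
    simp only [χ]; rw [min_eq_left (by linarith), max_eq_right zero_le_one]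
  let h : E → E := fun x => x + χ x • (f x - x)
  have hhc : Continuous h := by fun_prop
  have hhout : ∀ x, 3 / 4 ≤ ‖x‖ → h x = x := fun x hx => by simp [h, hχout x hx]
  have hh0 : ∀ x, h x ≠ 0 := by
    intro x hx
    rcases le_or_gt ‖x‖ (1 / 2) with h1 | h1
    · have : h x = f x := by simp [h, hχin x h1]
      exact hne x (by linarith) (this ▸ hx)
    · rcases le_or_gt (3 / 4) ‖x‖ with h2 | h2
      · rw [hhout x h2] at hx; rw [hx, norm_zero] at h1; linarith
      · have h3 : ‖x‖ = ‖χ x • (f x - x)‖ := by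
          simpa only [norm_neg] using congrArg norm (eq_neg_of_add_eq_zero_left hx)
        rw [norm_smul, Real.norm_of_nonneg (hχ0 x)] at h3
        have h4 := hfd x (by linarith)
        nlinarith [hχ1 x, hχ0 x, norm_nonneg (f x - x)]
  have hU : {x : E | 3 / 4 < ‖x‖} ∈ 𝓝ˢ {x : E | 1 ≤ ‖x‖} :=
    (isOpen_lt continuous_const continuous_norm).mem_nhdsSet.2 fun x (hx : 1 ≤ ‖x‖) =>
      show 3 / 4 < ‖x‖ by linarith
  obtain ⟨G, hGs, hGd, hGe, -⟩ := hhc.exists_contDiff_approx_and_eqOn 1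
    (ε := fun x => ‖h x‖) hhc.norm (fun x => norm_pos_iff.2 (hh0 x))
    (isClosed_le continuous_const continuous_norm) hU
    (contDiff_id.contDiffOn.congr fun x (hx : 3 / 4 < ‖x‖) => hhout x hx.le)
  have hG0 : ∀ x, G x ≠ 0 := fun x hx => by
    have := hGd x
    rw [hx, dist_zero_left] at this
    exact this.false
  refine not_exists_contDiff_retraction_sphere (E := E) (r := fun x => (‖G x‖)⁻¹ • G x) ?_ ?_ ?_
  · have hGs' : ContDiff ℝ 1 G := by exact_mod_cast hGs
    exact ((hGs'.norm ℝ hG0).inv fun x => norm_ne_zero_iff.2 (hG0 x)).smul hGs'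
  · intro x
    rw [norm_smul, norm_inv, norm_norm, inv_mul_cancel₀ (norm_ne_zero_iff.2 (hG0 x))]
  · intro x hx
    have : G x = x := (hGe (show 1 ≤ ‖x‖ from hx.ge)).trans (hhout x (by linarith))
    simp [this, hx]

/-- The inverse of an injection of the ball into a space of smaller dimension would extend to the
whole space. A smooth approximation of the extension misses a point near `0`, although its
composition with the injection is close to the identity. -/
theorem not_injOn_closedBall_of_finrank_lt {W : Type} [NormedAddCommGroup W] [NormedSpace ℝ W]
    [FiniteDimensional ℝ W] (hdim : finrank ℝ W < finrank ℝ E) {f : E → W}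
    (hf : ContinuousOn f (closedBall 0 1)) (hinj : InjOn f (closedBall 0 1)) : False := by
  have : TietzeExtension.{0, 0} W := TietzeExtension.of_tvs ℝ
  have : TietzeExtension.{0, 0} E := TietzeExtension.of_tvs ℝ
  obtain ⟨F, hF⟩ := ContinuousMap.exists_restrict_eq isClosed_closedBall
    (⟨(closedBall (0 : E) 1).domRestrict f, hf.domRestrict⟩ : C(closedBall (0 : E) 1, W))
  have hFf : ∀ x (hx : x ∈ closedBall (0 : E) 1), F x = f x := fun x hx => by
    simpa using congrArg (fun k : C(closedBall (0 : E) 1, W) => k ⟨x, hx⟩) hF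
  have : CompactSpace (closedBall (0 : E) 1) :=
    isCompact_iff_compactSpace.1 (isCompact_closedBall 0 1)
  have hemb : IsClosedEmbedding ((closedBall (0 : E) 1).domRestrict f) :=
    hf.domRestrict.isClosedEmbedding hinj.injective
  obtain ⟨G, hG⟩ := ContinuousMap.exists_extension' hemb
    (⟨Subtype.val, continuous_subtype_val⟩ : C(closedBall (0 : E) 1, E))
  have hGf : ∀ x ∈ closedBall (0 : E) 1, G (F x) = x := fun x hx => by
    rw [hFf x hx]
    exact congrFun hG ⟨x, hx⟩
  obtain ⟨P, hPs, hPd, -⟩ := G.continuous.exists_contDiff_approx 1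
    (ε := fun _ => 1 / 4) continuous_const (fun _ => by norm_num)
  have hPs' : ContDiff ℝ 1 P := by exact_mod_cast hPs
  obtain ⟨c, hc, hcP⟩ := (hPs'.dense_compl_range_of_finrank_lt_finrank hdim).exists_dist_lt
    (0 : E) (show (0 : ℝ) < 1 / 4 by norm_num)
  obtain ⟨x, hx, hx0⟩ := exists_zero_of_norm_sub_le_half (f := fun x => P (F x) - c)
    ((hPs'.continuous.comp F.continuous).sub continuous_const) (fun x hx => by
      have h1 := hPd (F x)
      rw [hGf x (mem_closedBall_zero_iff.2 hx), dist_eq_norm] at h1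
      rw [dist_zero_left] at hcP
      calc ‖P (F x) - c - x‖ = ‖(P (F x) - x) - c‖ := by congr 1; abel
        _ ≤ ‖P (F x) - x‖ + ‖c‖ := norm_sub_le _ _
        _ ≤ 1 / 2 := by linarith)
  exact hc ⟨F x, sub_eq_zero.1 hx0⟩

/-- **Invariance of dimension**: a map that is continuous and injective near `0` cannot lower the
dimension. -/
theorem not_injOn_nhds_of_finrank_lt {V W : Type} [NormedAddCommGroup V] [NormedSpace ℝ V]
    [FiniteDimensional ℝ V] [NormedAddCommGroup W] [NormedSpace ℝ W] [FiniteDimensional ℝ W]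
    (hdim : finrank ℝ W < finrank ℝ V) {f : V → W} {s : Set V} (hs : s ∈ 𝓝 0)
    (hf : ContinuousOn f s) (hinj : InjOn f s) : False := by
  let e : EuclideanSpace ℝ (Fin (finrank ℝ V)) ≃L[ℝ] V :=
    ContinuousLinearEquiv.ofFinrankEq (by simp)
  have hpre : e ⁻¹' s ∈ 𝓝 0 := e.continuous.continuousAt (by simpa using hs)
  obtain ⟨ε, hε, hsub⟩ := nhds_basis_closedBall.mem_iff.1 hpre
  have hmaps : MapsTo (fun x => e (ε • x)) (closedBall 0 1) s := fun x hx => hsub (by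
    rw [mem_closedBall_zero_iff] at hx ⊢
    rw [norm_smul, Real.norm_of_nonneg hε.le]
    nlinarith)
  refine not_injOn_closedBall_of_finrank_lt (E := EuclideanSpace ℝ (Fin (finrank ℝ V)))
    (f := fun x => f (e (ε • x))) (by simpa using hdim) ?_ ?_
  · exact hf.comp (by fun_prop) hmaps
  · intro x hx y hy hxy
    have := e.injective (hinj (hmaps hx) (hmaps hy) hxy)
    exact smul_right_injective _ hε.ne' this

end InvarianceOfDimension

/-! ### Heisenberg pairs in a group -/

section HeisenbergPair

open Subgroup

/-- A pair of elements whose commutator generates the center and whose common centralizer is the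
center. -/
structure IsHeisenbergPair {G : Type} [Group G] (c s : G) : Prop where
  zpowers_commutator : zpowers ⁅c, s⁆ = center G
  mem_center : ∀ g : G, g * c = c * g → g * s = s * g → g ∈ center G

namespace IsHeisenbergPair

variable {G : Type} [Group G] {c s : G} (h : IsHeisenbergPair c s)
include h

theorem commutator_mem_center : ⁅c, s⁆ ∈ center G :=
  h.zpowers_commutator ▸ mem_zpowers _

theorem commute_commutator_zpow (g : G) (j : ℤ) : Commute (⁅c, s⁆ ^ j) g :=
  (mem_center_iff.1 (zpow_mem h.commutator_mem_center j) g).symm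

theorem zpow_mul_right (j : ℤ) : c ^ j * s = ⁅c, s⁆ ^ j * (s * c ^ j) := by
  have h1 : s⁻¹ * c * s = ⁅c, s⁆ * c := by
    have h0 : Commute ⁅c, s⁆ s := by simpa using h.commute_commutator_zpow s 1
    have h2 : s * (⁅c, s⁆ * c) = c * s := by
      rw [← mul_assoc, ← h0.eq, commutatorElement_def]
      group
    rw [mul_assoc, ← h2]; group
  have h3 : s⁻¹ * c ^ j * s = ⁅c, s⁆ ^ j * c ^ j := by
    have hc : Commute ⁅c, s⁆ c := by simpa using h.commute_commutator_zpow c 1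
    rw [← hc.mul_zpow, ← h1]
    simpa using (conj_zpow (a := s⁻¹) (b := c) (i := j)).symm
  calc c ^ j * s = s * (s⁻¹ * c ^ j * s) := by group
    _ = s * ⁅c, s⁆ ^ j * c ^ j := by rw [h3, mul_assoc]
    _ = _ := by rw [← (h.commute_commutator_zpow s j).eq, mul_assoc]

theorem mul_zpow_right (j : ℤ) : c * s ^ j = ⁅c, s⁆ ^ j * (s ^ j * c) := by
  have h1 : c * s * c⁻¹ = ⁅c, s⁆ * s := by rw [commutatorElement_def]; group
  have h3 : c * s ^ j * c⁻¹ = ⁅c, s⁆ ^ j * s ^ j := by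
    have hc : Commute ⁅c, s⁆ s := by simpa using h.commute_commutator_zpow s 1
    rw [← hc.mul_zpow, ← h1, conj_zpow]
  rw [← mul_assoc, ← h3]; group

/-- A monomial in `c` and `s` commutes with `c` and `s` up to powers of the commutator, whose
exponents are those of the monomial. -/
theorem zpow_mul_zpow_mem_center_iff (i j : ℤ) :
    c ^ i * s ^ j ∈ center G ↔ ⁅c, s⁆ ^ i = 1 ∧ ⁅c, s⁆ ^ j = 1 := by
  have hs : ∀ i j : ℤ, c ^ i * s ^ j * s = ⁅c, s⁆ ^ i * (s * (c ^ i * s ^ j)) := fun i j => by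
    rw [mul_assoc, (Commute.zpow_self s j).eq, ← mul_assoc, h.zpow_mul_right]
    simp only [mul_assoc]
  have hc : ∀ i j : ℤ, c * (c ^ i * s ^ j) = ⁅c, s⁆ ^ j * (c ^ i * s ^ j * c) := fun i j => by
    rw [← mul_assoc, (Commute.self_zpow c i).eq, mul_assoc, h.mul_zpow_right, ← mul_assoc,
      ← (h.commute_commutator_zpow (c ^ i) j).eq]
    simp only [mul_assoc]
  constructor
  · intro hm
    rw [mem_center_iff] at hm
    refine ⟨?_, ?_⟩
    · have := hs i j
      rw [← hm s] at this
      exact mul_eq_right.1 this.symm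
    · have := hc i j
      rw [hm c] at this
      exact mul_eq_right.1 this.symm
  · rintro ⟨h1, h2⟩
    refine h.mem_center _ ?_ ?_
    · rw [hc i j, h2, one_mul]
    · rw [hs i j, h1, one_mul]

theorem commute_mk : Commute (c : G ⧸ center G) (s : G ⧸ center G) := by
  rw [← commutatorElement_eq_one_iff_commute, ← QuotientGroup.mk'_apply,
    ← QuotientGroup.mk'_apply, ← map_commutatorElement, QuotientGroup.mk'_apply,
    QuotientGroup.eq_one_iff]
  exact h.commutator_mem_center

theorem mk_zpow_mul_mk_zpow_eq_one_iff (i j : ℤ) :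
    (c : G ⧸ center G) ^ i * (s : G ⧸ center G) ^ j = 1 ↔
      (Nat.card (center G) : ℤ) ∣ i ∧ (Nat.card (center G) : ℤ) ∣ j := by
  rw [← QuotientGroup.mk_zpow, ← QuotientGroup.mk_zpow, ← QuotientGroup.mk_mul,
    QuotientGroup.eq_one_iff, h.zpow_mul_zpow_mem_center_iff, ← orderOf_dvd_iff_zpow_eq_one,
    ← orderOf_dvd_iff_zpow_eq_one, ← h.zpowers_commutator, Nat.card_zpowers]

theorem mk_pow_card : (c : G ⧸ center G) ^ Nat.card (center G) = 1 := by
  simpa using (h.mk_zpow_mul_mk_zpow_eq_one_iff (Nat.card (center G)) 0).2 (by simp)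

theorem mk_pow_card' : (s : G ⧸ center G) ^ Nat.card (center G) = 1 := by
  simpa using (h.mk_zpow_mul_mk_zpow_eq_one_iff 0 (Nat.card (center G))).2 (by simp)

/-- Elements of the subgroup generated by the images of a Heisenberg pair. -/
theorem mem_closure_iff (x : G ⧸ center G) :
    x ∈ closure {(c : G ⧸ center G), (s : G ⧸ center G)} ↔
      ∃ i j : ℤ, (c : G ⧸ center G) ^ i * (s : G ⧸ center G) ^ j = x := by
  constructor
  · intro hx
    induction hx using closure_induction with
    | mem x hx =>
      rcases hx with rfl | rfl
      · exact ⟨1, 0, by simp⟩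
      · exact ⟨0, 1, by simp⟩
    | one => exact ⟨0, 0, by simp⟩
    | mul x y _ _ hx hy =>
      obtain ⟨i, j, rfl⟩ := hx
      obtain ⟨k, l, rfl⟩ := hy
      refine ⟨i + k, j + l, ?_⟩
      rw [zpow_add, zpow_add]
      simp only [mul_assoc]
      rw [← mul_assoc (_ ^ k) (_ ^ j), (h.commute_mk.zpow_zpow k j).eq, mul_assoc]
    | inv x _ hx =>
      obtain ⟨i, j, rfl⟩ := hx
      refine ⟨-i, -j, ?_⟩
      rw [mul_inv_rev, zpow_neg, zpow_neg, ← zpow_neg, ← zpow_neg,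
        (h.commute_mk.zpow_zpow (-i) (-j)).eq]
  · rintro ⟨i, j, rfl⟩
    exact mul_mem (zpow_mem (subset_closure (by simp)) i) (zpow_mem (subset_closure (by simp)) j)

/-- The images of a Heisenberg pair generate a group isomorphic to `(ℤ/n)²`, with `n` the order of
the center. -/
theorem nonempty_closure_mulEquiv :
    Nonempty (closure {(c : G ⧸ center G), (s : G ⧸ center G)} ≃*
      Multiplicative (ZMod (Nat.card (center G)) × ZMod (Nat.card (center G)))) := by
  set n := Nat.card (center G) with hn
  have key : ∀ {x : G ⧸ center G}, x ^ n = 1 → (zmultiplesHom (Additive (G ⧸ center G))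
      (Additive.ofMul x)) (n : ℤ) = 0 := fun {x} hx => by
    simp only [zmultiplesHom_apply, natCast_zsmul]
    exact congrArg Additive.ofMul hx
  let f₁ : Multiplicative (ZMod n) →* G ⧸ center G :=
    AddMonoidHom.toMultiplicativeLeft (ZMod.lift n ⟨_, key h.mk_pow_card⟩)
  let f₂ : Multiplicative (ZMod n) →* G ⧸ center G :=
    AddMonoidHom.toMultiplicativeLeft (ZMod.lift n ⟨_, key h.mk_pow_card'⟩)
  have hf₁ : ∀ i : ℤ, f₁ (Multiplicative.ofAdd (i : ZMod n)) = (c : G ⧸ center G) ^ i := fun i => by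
    simp [f₁]
  have hf₂ : ∀ i : ℤ, f₂ (Multiplicative.ofAdd (i : ZMod n)) = (s : G ⧸ center G) ^ i := fun i => by
    simp [f₂]
  have hsurj : ∀ a : Multiplicative (ZMod n), ∃ i : ℤ, a = Multiplicative.ofAdd (i : ZMod n) :=
    fun a => (ZMod.intCast_surjective a.toAdd).imp fun i hi => by rw [hi]; rfl
  let F := f₁.noncommCoprod f₂ fun a b => by
    obtain ⟨i, rfl⟩ := hsurj a
    obtain ⟨j, rfl⟩ := hsurj b
    rw [hf₁, hf₂]
    exact h.commute_mk.zpow_zpow i j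
  have hF : Function.Injective F := by
    rw [injective_iff_map_eq_one]
    rintro ⟨a, b⟩ hab
    obtain ⟨i, rfl⟩ := hsurj a
    obtain ⟨j, rfl⟩ := hsurj b
    rw [MonoidHom.noncommCoprod_apply, hf₁, hf₂, h.mk_zpow_mul_mk_zpow_eq_one_iff] at hab
    rw [(ZMod.intCast_zmod_eq_zero_iff_dvd i n).2 hab.1,
      (ZMod.intCast_zmod_eq_zero_iff_dvd j n).2 hab.2]
    rfl
  have hrange : F.range = closure {(c : G ⧸ center G), (s : G ⧸ center G)} := by
    ext x
    rw [h.mem_closure_iff, MonoidHom.mem_range]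
    constructor
    · rintro ⟨⟨a, b⟩, rfl⟩
      obtain ⟨i, rfl⟩ := hsurj a
      obtain ⟨j, rfl⟩ := hsurj b
      exact ⟨i, j, by rw [MonoidHom.noncommCoprod_apply, hf₁, hf₂]⟩
    · rintro ⟨i, j, rfl⟩
      exact ⟨(Multiplicative.ofAdd (i : ZMod n), Multiplicative.ofAdd (j : ZMod n)), by
        rw [MonoidHom.noncommCoprod_apply, hf₁, hf₂]⟩
  exact ⟨((MulEquiv.subgroupCongr hrange).symm.trans (MonoidHom.ofInjective hF).symm).trans
    (MulEquiv.prodMultiplicative _ _).symm⟩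

/-- The subgroup generated by the images of a Heisenberg pair in `G / Z(G)` is the centralizer of
these images. -/
theorem mem_closure_of_commute {x : G ⧸ center G} (hc : Commute x (c : G ⧸ center G))
    (hs : Commute x (s : G ⧸ center G)) :
    x ∈ closure {(c : G ⧸ center G), (s : G ⧸ center G)} := by
  obtain ⟨g, rfl⟩ := QuotientGroup.mk_surjective x
  have key : ∀ y : G, Commute (g : G ⧸ center G) (y : G ⧸ center G) →
      ∃ i : ℤ, g * y = ⁅c, s⁆ ^ i * (y * g) := by
    intro y hy
    rw [← commutatorElement_eq_one_iff_commute, ← QuotientGroup.mk'_apply,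
      ← QuotientGroup.mk'_apply, ← map_commutatorElement, QuotientGroup.mk'_apply,
      QuotientGroup.eq_one_iff, ← h.zpowers_commutator, mem_zpowers_iff] at hy
    obtain ⟨i, hi⟩ := hy
    exact ⟨i, by rw [hi, commutatorElement_def]; group⟩
  obtain ⟨i, hi⟩ := key c hc
  obtain ⟨j, hj⟩ := key s hs
  -- correct `g` by powers of `s` and `c` so that it commutes with both
  have hmem : s ^ i * (c ^ (-j) * g) ∈ center G := by
    refine h.mem_center _ ?_ ?_
    · calc s ^ i * (c ^ (-j) * g) * c = s ^ i * (c ^ (-j) * (⁅c, s⁆ ^ i * (c * g))) := by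
            rw [← hi]; simp only [mul_assoc]
        _ = ⁅c, s⁆ ^ i * (s ^ i * (c ^ (-j) * (c * g))) := by
            rw [← mul_assoc (c ^ (-j)), ← (h.commute_commutator_zpow (c ^ (-j)) i).eq,
              mul_assoc, ← mul_assoc (s ^ i), ← (h.commute_commutator_zpow (s ^ i) i).eq, mul_assoc]
        _ = ⁅c, s⁆ ^ i * (s ^ i * c) * (c ^ (-j) * g) := by
            rw [← mul_assoc (c ^ (-j)), ← (Commute.self_zpow c (-j)).eq]
            simp only [mul_assoc]
        _ = c * (s ^ i * (c ^ (-j) * g)) := by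
            rw [← h.mul_zpow_right]; simp only [mul_assoc]
    · calc s ^ i * (c ^ (-j) * g) * s = s ^ i * (c ^ (-j) * (⁅c, s⁆ ^ j * (s * g))) := by
            rw [← hj]; simp only [mul_assoc]
        _ = s ^ i * (⁅c, s⁆ ^ j * (c ^ (-j) * s * g)) := by
            rw [← mul_assoc (c ^ (-j)), ← (h.commute_commutator_zpow (c ^ (-j)) j).eq]
            simp only [mul_assoc]
        _ = s ^ i * (s * (c ^ (-j) * g)) := by
            rw [h.zpow_mul_right (-j)]
            simp only [← mul_assoc]
            rw [mul_assoc (s ^ i), ← zpow_add]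
            simp
        _ = s * (s ^ i * (c ^ (-j) * g)) := by
            rw [← mul_assoc, ← (Commute.self_zpow s i).eq, mul_assoc]
  rw [← QuotientGroup.eq_one_iff] at hmem
  rw [h.mem_closure_iff]
  refine ⟨j, -i, ?_⟩
  have h2 : (s : G ⧸ center G) ^ i * ((c : G ⧸ center G) ^ (-j) * (g : G ⧸ center G)) = 1 := hmem
  calc (c : G ⧸ center G) ^ j * (s : G ⧸ center G) ^ (-i)
      = (c : G ⧸ center G) ^ j * ((s : G ⧸ center G) ^ (-i) *
        ((s : G ⧸ center G) ^ i * ((c : G ⧸ center G) ^ (-j) * (g : G ⧸ center G)))) := by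
        rw [h2, mul_one]
    _ = g := by group

/-- For `k` coprime to the order of the center, `c ^ k` and `s` have the same common centralizer in
`G / Z(G)` as `c` and `s`. -/
theorem commute_mk_pow_iff {k : ℕ} (hk : k.Coprime (Nat.card (center G)))
    (x : G ⧸ center G) :
    (Commute x ((c ^ k : G) : G ⧸ center G) ∧ Commute x (s : G ⧸ center G)) ↔
      x ∈ closure {(c : G ⧸ center G), (s : G ⧸ center G)} := by
  constructor
  · rintro ⟨h1, h2⟩
    obtain ⟨m, hm⟩ := exists_pow_eq_self_of_coprime
      (hk.coprime_dvd_right (orderOf_dvd_of_pow_eq_one h.mk_pow_card))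
    refine h.mem_closure_of_commute ?_ h2
    rw [← hm]
    exact h1.pow_right m
  · intro hx
    obtain ⟨i, j, rfl⟩ := (h.mem_closure_iff x).1 hx
    refine ⟨?_, ?_⟩
    · rw [QuotientGroup.mk_pow]
      exact (((Commute.refl _).zpow_left i).mul_left (h.commute_mk.symm.zpow_left j)).pow_right k
    · exact (h.commute_mk.zpow_left i).mul_left ((Commute.refl _).zpow_left j)

theorem commutator_pow_left (k : ℕ) : ⁅c ^ k, s⁆ = ⁅c, s⁆ ^ k := by
  have := h.zpow_mul_right k
  simp only [zpow_natCast] at this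
  rw [commutatorElement_def, this]
  group

end IsHeisenbergPair

end HeisenbergPair

/-! ### The special unitary group -/

namespace SU

variable {r : ℕ}

theorem star_mul_self (x : SU r) : star x.1 * x.1 = 1 := (Matrix.mem_unitaryGroup_iff').1 x.2.1

theorem mul_star_self (x : SU r) : x.1 * star x.1 = 1 := (Matrix.mem_unitaryGroup_iff).1 x.2.1

theorem det_eq_one (x : SU r) : x.1.det = 1 := x.2.2

instance : IsTopologicalGroup (SU r) where
  continuous_inv := Continuous.subtype_mk (continuous_star.comp continuous_subtype_val) _

instance : CompactSpace (SU r) := by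
  refine (isCompact_iff_compactSpace
    (s := (Matrix.specialUnitaryGroup (Fin r) ℂ : Set (Matrix (Fin r) (Fin r) ℂ)))).1 ?_
  have hsub : ((Matrix.specialUnitaryGroup (Fin r) ℂ : Set (Matrix (Fin r) (Fin r) ℂ))) ⊆
      Set.pi Set.univ fun _ => Set.pi Set.univ fun _ => Metric.closedBall (0 : ℂ) 1 :=
    fun U hU i _ j _ => mem_closedBall_zero_iff.2 (entry_norm_bound_of_unitary hU.1 i j)
  refine (isCompact_univ_pi fun _ => isCompact_univ_pi fun _ =>
    isCompact_closedBall (0 : ℂ) 1).of_isClosed_subset ?_ hsub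
  have : ((Matrix.specialUnitaryGroup (Fin r) ℂ : Set (Matrix (Fin r) (Fin r) ℂ))) =
      {U | U * star U = 1} ∩ {U | U.det = 1} := by
    ext U
    rw [SetLike.mem_coe, Matrix.mem_specialUnitaryGroup_iff, Matrix.mem_unitaryGroup_iff]
    rfl
  rw [this]
  exact (isClosed_eq (continuous_id.mul continuous_star) continuous_const).inter
    (isClosed_eq continuous_id.matrix_det continuous_const)

/-- A unitary matrix can be scaled to determinant one. -/
theorem exists_smul_mem {U : Matrix (Fin r) (Fin r) ℂ} (hr : r ≠ 0)
    (hU : U ∈ Matrix.unitaryGroup (Fin r) ℂ) :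
    ∃ z : ℂ, ‖z‖ = 1 ∧ z • U ∈ Matrix.specialUnitaryGroup (Fin r) ℂ := by
  have hdet : ‖U.det‖ = 1 := by
    have := congrArg Matrix.det ((Matrix.mem_unitaryGroup_iff').1 hU)
    rw [Matrix.det_mul, Matrix.star_eq_conjTranspose, Matrix.det_conjTranspose,
      Matrix.det_one] at this
    have h2 := congrArg norm this
    rw [norm_mul, norm_star, norm_one] at h2
    nlinarith [norm_nonneg U.det]
  obtain ⟨z, hz⟩ := IsAlgClosed.exists_pow_nat_eq (U.det)⁻¹ (Nat.pos_of_ne_zero hr)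
  have hz1 : ‖z‖ = 1 := by
    have := congrArg norm hz
    rw [norm_pow, norm_inv, hdet, inv_one] at this
    exact (pow_eq_one_iff_of_nonneg (norm_nonneg z) hr).1 this
  refine ⟨z, hz1, ?_⟩
  rw [Matrix.mem_specialUnitaryGroup_iff, Matrix.mem_unitaryGroup_iff']
  refine ⟨?_, ?_⟩
  · rw [star_smul, smul_mul_smul_comm, (Matrix.mem_unitaryGroup_iff').1 hU, Complex.star_def,
      ← Complex.normSq_eq_conj_mul_self, Complex.normSq_eq_norm_sq, hz1]
    simp
  · rw [Matrix.det_smul, Fintype.card_fin, hz, inv_mul_cancel₀]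
    rw [← norm_ne_zero_iff, hdet]; exact one_ne_zero

theorem mem_center_of_eq_smul {x : SU r} {z : ℂ} (hx : x.1 = z • (1 : Matrix (Fin r) (Fin r) ℂ)) :
    x ∈ Subgroup.center (SU r) := by
  rw [Subgroup.mem_center_iff]
  intro g
  apply Subtype.ext
  change g.1 * x.1 = x.1 * g.1
  simp [hx]

theorem pow_eq_one_of_eq_smul {x : SU r} {z : ℂ}
    (hx : x.1 = z • (1 : Matrix (Fin r) (Fin r) ℂ)) : z ^ r = 1 := by
  have := x.det_eq_one
  simpa [hx, Matrix.det_smul] using this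

theorem coe_pow_of_eq_smul {x : SU r} {z : ℂ}
    (hx : x.1 = z • (1 : Matrix (Fin r) (Fin r) ℂ)) (n : ℕ) :
    (x ^ n).1 = z ^ n • (1 : Matrix (Fin r) (Fin r) ℂ) := by
  rw [SubmonoidClass.coe_pow, hx, smul_pow, one_pow]

end SU

/-! ### The clock and shift matrices -/

namespace PU

/-- The clock matrix as an element of `SU(r)`. -/
noncomputable def clock (r : ℕ) : SU r := ⟨clockMatrix r, clockMatrix_mem r⟩

/-- The shift matrix as an element of `SU(r)`. -/
noncomputable def shift (r : ℕ) : SU r := ⟨shiftMatrix r, shiftMatrix_mem r⟩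

theorem phase_ne_zero (r : ℕ) (k : ℝ) : phase r k ≠ 0 := Complex.exp_ne_zero _

/-- The inverse of the standard primitive `r`-th root of unity. -/
noncomputable def root (r : ℕ) : ℂ := (Complex.exp (2 * Real.pi * Complex.I / r))⁻¹

theorem phase_natCast {r : ℕ} (k : ℕ) : phase r k = phase r 0 * (root r)⁻¹ ^ k := by
  rw [root, inv_inv, ← Complex.exp_nat_mul, phase, phase, ← Complex.exp_add]
  congr 1
  push_cast
  ring

variable {r : ℕ} [NeZero r]

theorem root_isPrimitiveRoot : IsPrimitiveRoot (root r) r :=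
  (Complex.isPrimitiveRoot_exp r (NeZero.ne r)).inv

theorem root_mul_phase_val_add_one (k : Fin r) :
    root r * phase r ((k + 1 : Fin r) : ℕ) = phase r (k : ℕ) := by
  have h0 : root r ≠ 0 := root_isPrimitiveRoot.ne_zero (NeZero.ne r)
  have hmod : (root r)⁻¹ ^ (((k : ℕ) + 1) % r) = (root r)⁻¹ ^ ((k : ℕ) + 1) := by
    conv_rhs => rw [← Nat.mod_add_div ((k : ℕ) + 1) r, pow_add, pow_mul,
      (root_isPrimitiveRoot (r := r)).inv.pow_eq_one, one_pow, mul_one]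
  have hv : ((k + 1 : Fin r) : ℕ) = ((k : ℕ) + 1) % r := by
    rw [Fin.val_add, Fin.val_one', Nat.add_mod_mod]
  rw [phase_natCast, phase_natCast, hv, hmod, pow_succ]
  field_simp

theorem shiftMatrix_apply (i j : Fin r) :
    shiftMatrix r i j = if i + 1 = j then phase r 0 else 0 := by
  simp [shiftMatrix, Equiv.Perm.permMatrix, PEquiv.toMatrix_apply, Equiv.toPEquiv_apply,
    finRotate_apply, eq_comm]

theorem clockMatrix_mul_shiftMatrix :
    clockMatrix r * shiftMatrix r = root r • (shiftMatrix r * clockMatrix r) := by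
  ext i j
  rw [clockMatrix, Matrix.diagonal_mul, Matrix.smul_apply, Matrix.mul_diagonal,
    shiftMatrix_apply, smul_eq_mul]
  split_ifs with h
  · subst h
    rw [← root_mul_phase_val_add_one i]
    ring
  · simp

theorem commutator_clock_shift :
    (⁅clock r, shift r⁆ : SU r).1 = root r • (1 : Matrix (Fin r) (Fin r) ℂ) := by
  have h : (clock r).1 * (shift r).1 = root r • ((shift r).1 * (clock r).1) :=
    clockMatrix_mul_shiftMatrix
  rw [commutatorElement_def]
  change (clock r).1 * (shift r).1 * star (clock r).1 * star (shift r).1 = _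
  rw [h, smul_mul_assoc, smul_mul_assoc, mul_assoc (shift r).1, SU.mul_star_self, mul_one,
    SU.mul_star_self]

/-- A matrix that commutes with the clock and the shift matrix is scalar. -/
theorem exists_eq_smul_one_of_commute {M : Matrix (Fin r) (Fin r) ℂ}
    (hc : M * clockMatrix r = clockMatrix r * M) (hs : M * shiftMatrix r = shiftMatrix r * M) :
    ∃ z : ℂ, M = z • (1 : Matrix (Fin r) (Fin r) ℂ) := by
  have hoff : ∀ i j, i ≠ j → M i j = 0 := by
    intro i j hij
    have h := congrFun (congrFun hc i) j
    rw [clockMatrix, Matrix.mul_diagonal, Matrix.diagonal_mul, phase_natCast, phase_natCast] at h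
    by_contra hM
    apply hij
    have h2 : (root r)⁻¹ ^ (j : ℕ) = (root r)⁻¹ ^ (i : ℕ) := by
      apply mul_left_cancel₀ (mul_ne_zero hM (phase_ne_zero r 0))
      linear_combination h
    exact (Fin.ext ((root_isPrimitiveRoot (r := r)).inv.pow_inj j.2 i.2 h2)).symm
  have hdiag : ∀ i : Fin r, M (i + 1) (i + 1) = M i i := by
    intro i
    have h := congrFun (congrFun hs i) (i + 1)
    rw [Matrix.mul_apply, Matrix.mul_apply, Finset.sum_eq_single i, Finset.sum_eq_single (i + 1)]
      at h
    · simp only [shiftMatrix_apply, if_true] at h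
      exact mul_left_cancel₀ (phase_ne_zero r 0) (by rw [← h, mul_comm])
    · intro k _ hk
      rw [hoff _ _ hk, mul_zero]
    · simp
    · intro k _ hk
      rw [hoff _ _ hk.symm, zero_mul]
    · simp
  have hall : ∀ n : ℕ, M (Fin.ofNat r n) (Fin.ofNat r n) = M 0 0 := by
    intro n
    induction n with
    | zero => rfl
    | succ n ih =>
      have : Fin.ofNat r (n + 1) = Fin.ofNat r n + 1 := by
        ext; simp [Fin.val_add]
      rw [this, hdiag, ih]
  refine ⟨M 0 0, ?_⟩
  ext i j
  rcases eq_or_ne i j with rfl | hij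
  · have := hall i
    rw [show Fin.ofNat r (i : ℕ) = i from Fin.ext (Nat.mod_eq_of_lt i.2)] at this
    simpa using this
  · simp [hoff i j hij, hij]

theorem _root_.SU.mem_center_iff {x : SU r} :
    x ∈ Subgroup.center (SU r) ↔ ∃ z : ℂ, x.1 = z • (1 : Matrix (Fin r) (Fin r) ℂ) := by
  refine ⟨fun hx => ?_, fun ⟨z, hz⟩ => SU.mem_center_of_eq_smul hz⟩
  rw [Subgroup.mem_center_iff] at hx
  exact exists_eq_smul_one_of_commute (congrArg Subtype.val (hx (clock r))).symm
    (congrArg Subtype.val (hx (shift r))).symm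

theorem smul_one_injective {z w : ℂ}
    (h : z • (1 : Matrix (Fin r) (Fin r) ℂ) = w • (1 : Matrix (Fin r) (Fin r) ℂ)) : z = w := by
  simpa using congrFun (congrFun h 0) 0

theorem _root_.SU.orderOf_of_eq_smul {x : SU r} {z : ℂ}
    (hx : x.1 = z • (1 : Matrix (Fin r) (Fin r) ℂ)) : orderOf x = orderOf z := by
  apply orderOf_eq_orderOf_iff.2
  intro n
  constructor
  · intro h
    have := SU.coe_pow_of_eq_smul hx n
    rw [h] at this
    exact smul_one_injective (r := r) (by rw [← this, one_smul]; rfl)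
  · intro h
    apply Subtype.ext
    rw [SU.coe_pow_of_eq_smul hx, h, one_smul]
    rfl

theorem isHeisenbergPair_clock_shift : IsHeisenbergPair (clock r) (shift r) where
  zpowers_commutator := by
    apply le_antisymm
    · rw [Subgroup.zpowers_le]
      exact SU.mem_center_of_eq_smul commutator_clock_shift
    · intro x hx
      obtain ⟨z, hz⟩ := SU.mem_center_iff.1 hx
      obtain ⟨i, -, hi⟩ := root_isPrimitiveRoot.eq_pow_of_pow_eq_one (SU.pow_eq_one_of_eq_smul hz)
      refine ⟨i, Subtype.ext ?_⟩
      simp only [zpow_natCast]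
      rw [SU.coe_pow_of_eq_smul commutator_clock_shift, hi, hz]
  mem_center g hc hs := SU.mem_center_iff.2
    (exists_eq_smul_one_of_commute (congrArg Subtype.val hc) (congrArg Subtype.val hs))

theorem card_center : Nat.card (Subgroup.center (SU r)) = r := by
  rw [← isHeisenbergPair_clock_shift.zpowers_commutator, Nat.card_zpowers,
    SU.orderOf_of_eq_smul commutator_clock_shift, ← root_isPrimitiveRoot.eq_orderOf]

theorem finite_center : Finite (Subgroup.center (SU r)) :=
  Nat.finite_of_card_ne_zero (by rw [card_center]; exact NeZero.ne r)

theorem zpowers_eq_center_iff {x : SU r} (hx : x ∈ Subgroup.center (SU r)) :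
    Subgroup.zpowers x = Subgroup.center (SU r) ↔ orderOf x = r := by
  have := finite_center (r := r)
  constructor
  · intro h
    rw [← Nat.card_zpowers, h, card_center]
  · intro h
    exact Subgroup.eq_of_le_of_card_ge (Subgroup.zpowers_le.2 hx) (by
      rw [card_center, Nat.card_zpowers, h])

end PU

/-! ### Normal form of pairs of unitary operators that commute up to a root of unity -/

section NormalForm

open Module

theorem Module.End.exists_common_eigenvector {W : Type*} [AddCommGroup W] [Module ℂ W]
    [FiniteDimensional ℂ W] [Nontrivial W] {f g : End ℂ W} (hfg : ∀ v, f (g v) = g (f v)) :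
    ∃ (v : W) (a b : ℂ), v ≠ 0 ∧ f v = a • v ∧ g v = b • v := by
  obtain ⟨a, ha⟩ := Module.End.exists_eigenvalue f
  have hmaps : ∀ v ∈ f.eigenspace a, g v ∈ f.eigenspace a := fun v hv => by
    rw [Module.End.mem_eigenspace_iff] at hv ⊢
    rw [hfg, hv, map_smul]
  have : Nontrivial (f.eigenspace a) := by
    obtain ⟨v, hv⟩ := ha.exists_hasEigenvector
    exact ⟨⟨v, hv.1⟩, 0, fun h => hv.2 (congrArg Subtype.val h)⟩
  obtain ⟨b, hb⟩ := Module.End.exists_eigenvalue (g.restrict hmaps)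
  obtain ⟨v, hv⟩ := hb.exists_hasEigenvector
  refine ⟨v.1, a, b, fun h => hv.2 (Subtype.ext h), Module.End.mem_eigenspace_iff.1 v.2, ?_⟩
  have := congrArg Subtype.val hv.apply_eq_smul
  simpa using this

variable {V : Type} [NormedAddCommGroup V] [InnerProductSpace ℂ V]

/-- Two linear operators that preserve the inner product and commute up to the scalar `ζ`. -/
structure IsTwistedPair (ζ : ℂ) (X Y : V →ₗ[ℂ] V) : Prop where
  inner_left : ∀ u v, inner ℂ (X u) (X v) = inner ℂ u v
  inner_right : ∀ u v, inner ℂ (Y u) (Y v) = inner ℂ u v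
  comm : ∀ v, X (Y v) = ζ • Y (X v)

/-- A family of vectors on which `X` acts as a block clock matrix, and `Y` as a block shift
matrix. -/
structure IsClockShiftFamily {ι : Type} {d : ℕ} (ζ : ℂ) (X Y : V →ₗ[ℂ] V) (e : ι × ZMod d → V)
    (a b : ι → ℂ) : Prop where
  norm_left : ∀ i, ‖a i‖ = 1
  norm_right : ∀ i, ‖b i‖ = 1
  orthonormal : Orthonormal ℂ e
  apply_left : ∀ p, X (e p) = (a p.1 * ζ ^ p.2.val) • e p
  apply_right : ∀ p, Y (e p) = b p.1 • e (p.1, p.2 + 1)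

theorem norm_eigenvalue_eq_one {X : V →ₗ[ℂ] V} (hX : ∀ u v, inner ℂ (X u) (X v) = inner ℂ u v)
    {v : V} {a : ℂ} (hv : v ≠ 0) (h : X v = a • v) : ‖a‖ = 1 := by
  have h1 : ‖X v‖ = ‖v‖ := by
    rw [@norm_eq_sqrt_re_inner ℂ, @norm_eq_sqrt_re_inner ℂ, hX]
  rw [h, norm_smul] at h1
  exact (mul_eq_right₀ (norm_ne_zero_iff.2 hv)).1 h1

theorem pow_val_add_one {d : ℕ} [NeZero d] {M : Type*} [Monoid M] {z : M} (hz : z ^ d = 1)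
    (j : ZMod d) : z ^ (j + 1).val = z ^ (j.val + 1) := by
  have hv : (j + 1).val = (j.val + 1) % d := by
    rw [ZMod.val_add, ZMod.val_one_eq_one_mod, Nat.add_mod_mod]
  conv_rhs => rw [← Nat.mod_add_div (j.val + 1) d, pow_add, pow_mul, hz, one_pow, mul_one]
  rw [hv]

/-- The orbit of a common eigenvector of `X` and `Y ^ d` under `Y`. -/
theorem IsTwistedPair.exists_family_of_eigenvector {d : ℕ} [NeZero d] {ζ : ℂ}
    (hζ : IsPrimitiveRoot ζ d) {X Y : V →ₗ[ℂ] V} (h : IsTwistedPair ζ X Y)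
    {v : V} {a b : ℂ} (hv : v ≠ 0) (ha : X v = a • v) (hb : (Y ^ d) v = b • v)
    {W : Submodule ℂ V} (hvW : v ∈ W) (hY : ∀ w ∈ W, Y w ∈ W) :
    ∃ (e : Unit × ZMod d → V) (a b : Unit → ℂ), IsClockShiftFamily ζ X Y e a b ∧
      ∀ p, e p ∈ W := by
  have hd : d ≠ 0 := NeZero.ne d
  have hYd : ∀ n : ℕ, ∀ u w, inner ℂ ((Y ^ n) u) ((Y ^ n) w) = inner ℂ u w := by
    intro n
    induction n with
    | zero => intro u w; rfl
    | succ n ih => intro u w; rw [pow_succ']; exact (h.inner_right _ _).trans (ih u w)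
  have hnormY : ∀ (n : ℕ) u, ‖(Y ^ n) u‖ = ‖u‖ := fun n u => by
    rw [@norm_eq_sqrt_re_inner ℂ, @norm_eq_sqrt_re_inner ℂ, hYd]
  have hb1 : ‖b‖ = 1 := norm_eigenvalue_eq_one (hYd d) hv hb
  have ha1 : ‖a‖ = 1 := norm_eigenvalue_eq_one h.inner_left hv ha
  obtain ⟨μ, hμ⟩ := IsAlgClosed.exists_pow_nat_eq b (Nat.pos_of_ne_zero hd)
  have hμ1 : ‖μ‖ = 1 := by
    have := congrArg norm hμ
    rw [norm_pow, hb1] at this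
    exact (pow_eq_one_iff_of_nonneg (norm_nonneg μ) hd).1 this
  have hμ0 : μ ≠ 0 := norm_ne_zero_iff.1 (by rw [hμ1]; exact one_ne_zero)
  -- divide by `μ` at each step, where `μ ^ d = b`, so that the orbit closes up after `d` steps
  let c : ℂ := ((‖v‖ : ℝ) : ℂ)⁻¹
  let u : ℕ → V := fun n => (c * (μ⁻¹) ^ n) • (Y ^ n) v
  have hu_norm : ∀ n, ‖u n‖ = 1 := fun n => by
    simp only [u, c]
    rw [norm_smul, hnormY, norm_mul, norm_pow, norm_inv, norm_inv, hμ1, Complex.norm_real,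
      norm_norm]
    simp [hv]
  have hu_X : ∀ n, X (u n) = (a * ζ ^ n) • u n := by
    have : ∀ n, X ((Y ^ n) v) = (a * ζ ^ n) • (Y ^ n) v := by
      intro n
      induction n with
      | zero => simp [ha]
      | succ n ih =>
        rw [pow_succ' Y, Module.End.mul_apply, h.comm, ih, map_smul, smul_smul]
        congr 1
        ring
    intro n
    simp only [u, map_smul, this, smul_smul]
    congr 1
    ring
  have hu_Y : ∀ n, Y (u n) = μ • u (n + 1) := fun n => by
    simp only [u, map_smul, smul_smul, pow_succ' Y, Module.End.mul_apply]
    congr 1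
    rw [pow_succ]
    field_simp
  have hu_per : ∀ n, u (n + d) = u n := fun n => by
    simp only [u]
    rw [pow_add Y, Module.End.mul_apply, hb, map_smul, smul_smul, ← hμ]
    congr 1
    rw [pow_add, inv_pow _ d, mul_assoc, mul_assoc, inv_mul_cancel₀ (pow_ne_zero d hμ0), mul_one]
  have hu_mod : ∀ n, u (n % d) = u n := fun n => by
    conv_rhs => rw [← Nat.mod_add_div n d]
    generalize n % d = k
    induction n / d with
    | zero => simp
    | succ q ih => rw [mul_add, mul_one, ← add_assoc, hu_per, ← ih]
  have hu_mem : ∀ n, u n ∈ W := fun n => by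
    apply W.smul_mem
    induction n with
    | zero => simpa using hvW
    | succ n ih => rw [pow_succ', Module.End.mul_apply]; exact hY _ ih
  refine ⟨fun p => u p.2.val, fun _ => a, fun _ => μ, ⟨fun _ => ha1, fun _ => hμ1,
    ⟨fun p => hu_norm _, ?_⟩, fun p => hu_X _, fun p => ?_⟩, fun p => hu_mem _⟩
  · rintro ⟨⟨⟩, j⟩ ⟨⟨⟩, k⟩ hjk
    have hne : ζ ^ j.val ≠ ζ ^ k.val := fun h =>
      hjk (by rw [ZMod.val_injective d (hζ.pow_inj (ZMod.val_lt j) (ZMod.val_lt k) h)])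
    -- eigenvectors of an isometry with distinct eigenvalues are orthogonal
    have hζ1 : ‖ζ‖ = 1 := hζ.norm'_eq_one hd
    have h1 := h.inner_left (u j.val) (u k.val)
    rw [hu_X, hu_X, inner_smul_left, inner_smul_right] at h1
    by_contra h0
    have h2 : (starRingEnd ℂ) (a * ζ ^ j.val) * (a * ζ ^ k.val) = 1 := by
      apply mul_right_cancel₀ h0
      rw [one_mul, mul_assoc]; exact h1
    have h3 : (starRingEnd ℂ) (a * ζ ^ j.val) * (a * ζ ^ j.val) = 1 := by
      rw [← Complex.normSq_eq_conj_mul_self, Complex.normSq_eq_norm_sq]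
      simp [ha1, hζ1]
    have h4 : a * ζ ^ j.val = a * ζ ^ k.val :=
      mul_left_cancel₀ (left_ne_zero_of_mul (h3 ▸ one_ne_zero)) (h3.trans h2.symm)
    exact hne (mul_left_cancel₀ (norm_ne_zero_iff.1 (by rw [ha1]; exact one_ne_zero)) h4)
  · rw [hu_Y, ZMod.val_add, ZMod.val_one_eq_one_mod, Nat.add_mod_mod, hu_mod]

/-- The orthogonal complement of a block clock and shift family is invariant. -/
theorem IsClockShiftFamily.apply_mem_orthogonal {ι : Type} {d : ℕ} [NeZero d] {ζ : ℂ} (hζ : ζ ≠ 0)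
    {X Y : V →ₗ[ℂ] V} (h : IsTwistedPair ζ X Y) {e : ι × ZMod d → V} {a b : ι → ℂ}
    (he : IsClockShiftFamily ζ X Y e a b) {w : V}
    (hw : w ∈ (Submodule.span ℂ (Set.range e))ᗮ) :
    X w ∈ (Submodule.span ℂ (Set.range e))ᗮ ∧ Y w ∈ (Submodule.span ℂ (Set.range e))ᗮ := by
  have hmem : ∀ {w : V}, w ∈ (Submodule.span ℂ (Set.range e))ᗮ ↔ ∀ p, inner ℂ (e p) w = 0 := by
    intro w
    rw [← Submodule.span_singleton_le_iff_mem, ← Submodule.isOrtho_iff_le, Submodule.isOrtho_comm,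
      Submodule.isOrtho_span]
    simp only [Set.mem_range, Set.mem_singleton_iff, forall_exists_index, forall_apply_eq_imp_iff,
      forall_eq]
  rw [hmem] at hw ⊢
  rw [hmem]
  constructor
  · intro p
    have h1 := h.inner_left (e p) w
    rw [hw p, he.apply_left, inner_smul_left] at h1
    refine (mul_eq_zero.1 h1).resolve_left ?_
    have : a p.1 ≠ 0 := norm_ne_zero_iff.1 (by rw [he.norm_left]; exact one_ne_zero)
    simp [this, hζ]
  · rintro ⟨i, j⟩
    have h1 := h.inner_right (e (i, j - 1)) w
    rw [hw, he.apply_right, inner_smul_left] at h1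
    have : b i ≠ 0 := norm_ne_zero_iff.1 (by rw [he.norm_right]; exact one_ne_zero)
    simpa [this] using h1

/-- Every invariant subspace has an orthonormal basis in block clock and shift form: split off the
orbit of a common eigenvector of `X` and `Y ^ d` and pass to the orthogonal complement. -/
theorem IsTwistedPair.exists_family [FiniteDimensional ℂ V] {d : ℕ} [NeZero d] {ζ : ℂ}
    (hζ : IsPrimitiveRoot ζ d) {X Y : V →ₗ[ℂ] V} (h : IsTwistedPair ζ X Y) (n : ℕ) :
    ∀ W : Submodule ℂ V, finrank ℂ W = n → (∀ w ∈ W, X w ∈ W) → (∀ w ∈ W, Y w ∈ W) →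
    ∃ (ι : Type) (_ : Fintype ι) (e : ι × ZMod d → V) (a b : ι → ℂ),
      IsClockShiftFamily ζ X Y e a b ∧ Submodule.span ℂ (Set.range e) = W := by
  induction n using Nat.strong_induction_on with
  | _ n ih =>
    intro W hn hX hY
    rcases eq_or_ne W ⊥ with rfl | hW
    · refine ⟨Empty, inferInstance, fun p => p.1.elim, Empty.elim, Empty.elim,
        ⟨fun i => i.elim, fun i => i.elim, ⟨fun p => p.1.elim, fun p => p.1.elim⟩,
          fun p => p.1.elim, fun p => p.1.elim⟩, ?_⟩
      rw [Set.range_eq_empty, Submodule.span_empty]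
    · have hnt : Nontrivial W := Submodule.nontrivial_iff_ne_bot.2 hW
      have hYn : ∀ n : ℕ, ∀ w ∈ W, (Y ^ n) w ∈ W := by
        intro n
        induction n with
        | zero => intro w hw; exact hw
        | succ n ih => intro w hw; rw [pow_succ']; exact hY _ (ih w hw)
      have hcomm : ∀ (n : ℕ) v, X ((Y ^ n) v) = ζ ^ n • (Y ^ n) (X v) := by
        intro n
        induction n with
        | zero => intro v; simp
        | succ n ih =>
          intro v
          rw [pow_succ' Y, Module.End.mul_apply, h.comm, ih, map_smul, smul_smul, ← pow_succ']
          rfl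
      obtain ⟨v, a, b, hv0, ha, hb⟩ := Module.End.exists_common_eigenvector
        (f := X.restrict hX) (g := (Y ^ d).restrict (hYn d)) (fun v => Subtype.ext (by
          have := hcomm d v
          rw [hζ.pow_eq_one, one_smul] at this
          exact this))
      obtain ⟨e₀, a₀, b₀, he₀, he₀W⟩ := h.exists_family_of_eigenvector hζ (v := v.1) (a := a) (b := b)
        (fun h => hv0 (Subtype.ext h)) (congrArg Subtype.val ha) (congrArg Subtype.val hb) v.2 hY
      set S := Submodule.span ℂ (Set.range e₀) with hS
      have hSW : S ≤ W := Submodule.span_le.2 (by rintro _ ⟨p, rfl⟩; exact he₀W p)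
      have hζ0 : ζ ≠ 0 := hζ.ne_zero (NeZero.ne d)
      have hlt : finrank ℂ (Sᗮ ⊓ W : Submodule ℂ V) < n := by
        rw [← hn]
        apply Submodule.finrank_lt_finrank_of_lt
        refine lt_of_le_of_ne inf_le_right fun heq => ?_
        have h1 : e₀ ((), 0) ∈ (Sᗮ ⊓ W : Submodule ℂ V) := heq.ge (he₀W _)
        have h2 : e₀ ((), 0) ∈ S := Submodule.subset_span ⟨_, rfl⟩
        have h3 := (Submodule.mem_orthogonal _ _).1 h1.1 _ h2
        rw [inner_self_eq_zero] at h3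
        have := he₀.orthonormal.1 ((), 0)
        rw [h3, norm_zero] at this
        exact zero_ne_one this
      obtain ⟨ι, hι, e₁, a₁, b₁, he₁, hspan⟩ := ih _ hlt (Sᗮ ⊓ W) rfl
        (fun w hw => ⟨(he₀.apply_mem_orthogonal hζ0 h hw.1).1, hX w hw.2⟩)
        (fun w hw => ⟨(he₀.apply_mem_orthogonal hζ0 h hw.1).2, hY w hw.2⟩)
      have horth : ∀ p q, inner ℂ (e₀ p) (e₁ q) = 0 := fun p q => by
        have h1 : e₁ q ∈ (Sᗮ ⊓ W : Submodule ℂ V) := hspan ▸ Submodule.subset_span ⟨q, rfl⟩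
        exact (Submodule.mem_orthogonal _ _).1 h1.1 _ (Submodule.subset_span ⟨p, rfl⟩)
      refine ⟨Unit ⊕ ι, inferInstance,
        fun p => Sum.elim (fun i => e₀ (i, p.2)) (fun i => e₁ (i, p.2)) p.1,
        Sum.elim a₀ a₁, Sum.elim b₀ b₁, ⟨?_, ?_, ⟨?_, ?_⟩, ?_, ?_⟩, ?_⟩
      · rintro (i | i)
        exacts [he₀.norm_left i, he₁.norm_left i]
      · rintro (i | i)
        exacts [he₀.norm_right i, he₁.norm_right i]
      · rintro ⟨i | i, j⟩
        exacts [he₀.orthonormal.1 _, he₁.orthonormal.1 _]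
      · rintro ⟨i | i, j⟩ ⟨k | k, l⟩ hne
        · exact he₀.orthonormal.2 fun h => hne (by simp only [Prod.mk.injEq] at h; simp [h])
        · exact horth _ _
        · exact inner_eq_zero_symm.1 (horth _ _)
        · exact he₁.orthonormal.2 fun h => hne (by simp only [Prod.mk.injEq] at h; simp [h])
      · rintro ⟨i | i, j⟩
        exacts [he₀.apply_left (i, j), he₁.apply_left (i, j)]
      · rintro ⟨i | i, j⟩
        exacts [he₀.apply_right (i, j), he₁.apply_right (i, j)]
      · have hr : Set.range (fun p : (Unit ⊕ ι) × ZMod d =>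
            Sum.elim (fun i => e₀ (i, p.2)) (fun i => e₁ (i, p.2)) p.1) =
            Set.range e₀ ∪ Set.range e₁ := by
          ext w
          simp only [Set.mem_range, Set.mem_union, Prod.exists, Sum.exists, Sum.elim_inl,
            Sum.elim_inr]
        rw [hr, Submodule.span_union, hspan, ← hS,
          Submodule.sup_orthogonal_inf_of_hasOrthogonalProjection hSW]

end NormalForm

/-! ### Block clock and shift matrices -/

namespace Block

open Matrix

variable {r m d : ℕ} (ε : Fin r ≃ Fin m × ZMod d)

/-- The diagonal matrix with entries `ζ ^ j`, where the basis is indexed by pairs `(i, j)` of a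
block `i` and a position `j` in the block. -/
noncomputable def clock (ζ : ℂ) : Matrix (Fin r) (Fin r) ℂ := diagonal fun k => ζ ^ (ε k).2.val

/-- The permutation matrix that moves each position in a block to the next one, cyclically. -/
def shift : Matrix (Fin r) (Fin r) ℂ :=
  of fun i k => if ε i = ((ε k).1, (ε k).2 + 1) then 1 else 0

/-- The diagonal matrix that is the scalar `c i` on the block `i`. -/
noncomputable def scalar (c : Fin m → ℂ) : Matrix (Fin r) (Fin r) ℂ := diagonal fun k => c (ε k).1

theorem diagonal_mem_unitaryGroup {c : Fin r → ℂ} (hc : ∀ k, ‖c k‖ = 1) :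
    diagonal c ∈ unitaryGroup (Fin r) ℂ := by
  rw [mem_unitaryGroup_iff', star_eq_conjTranspose, diagonal_conjTranspose,
    diagonal_mul_diagonal, ← diagonal_one]
  congr 1
  funext k
  rw [Pi.star_apply, Complex.star_def, ← Complex.normSq_eq_conj_mul_self,
    Complex.normSq_eq_norm_sq, hc]
  simp

theorem clock_mem {ζ : ℂ} (hζ : ‖ζ‖ = 1) : clock ε ζ ∈ unitaryGroup (Fin r) ℂ :=
  diagonal_mem_unitaryGroup fun k => by rw [norm_pow, hζ, one_pow]

theorem shift_mem : shift ε ∈ unitaryGroup (Fin r) ℂ := by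
  rw [mem_unitaryGroup_iff', star_eq_conjTranspose]
  ext i k
  simp only [mul_apply, conjTranspose_apply, shift, of_apply, apply_ite star, star_one, star_zero,
    ite_mul, one_mul, zero_mul, one_apply]
  rw [Finset.sum_eq_single (ε.symm ((ε i).1, (ε i).2 + 1))]
  · by_cases h : i = k
    · subst h; simp
    · have : ¬ (((ε i).1, (ε i).2 + 1) = ((ε k).1, (ε k).2 + 1)) := fun h2 => h (ε.injective (by
        rw [Prod.mk.injEq, add_left_inj] at h2
        exact Prod.ext h2.1 h2.2))
      simp only [Equiv.apply_symm_apply, this, h, if_true, if_false]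
  · intro b _ hb
    rw [if_neg]
    intro h
    exact hb (by rw [← h, Equiv.symm_apply_apply])
  · simp

theorem clock_mul_shift [NeZero d] {ζ : ℂ} (hζ : ζ ^ d = 1) :
    clock ε ζ * shift ε = ζ • (shift ε * clock ε ζ) := by
  ext i k
  rw [clock, diagonal_mul, Matrix.smul_apply, mul_diagonal, shift, of_apply, smul_eq_mul]
  split_ifs with h
  · rw [h, pow_val_add_one hζ, pow_succ]; ring
  · simp

theorem clock_mul_scalar (ζ : ℂ) (c : Fin m → ℂ) :
    clock ε ζ * scalar ε c = scalar ε c * clock ε ζ := by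
  rw [clock, scalar, diagonal_mul_diagonal, diagonal_mul_diagonal]
  simp only [mul_comm]

theorem shift_mul_scalar (c : Fin m → ℂ) : shift ε * scalar ε c = scalar ε c * shift ε := by
  ext i k
  rw [scalar, mul_diagonal, diagonal_mul, shift, of_apply]
  split_ifs with h
  · rw [h]; simp
  · simp

theorem scalar_mul_scalar (c c' : Fin m → ℂ) :
    scalar ε c * scalar ε c' = scalar ε (fun i => c i * c' i) := by
  rw [scalar, scalar, scalar, diagonal_mul_diagonal]

/-- Two unitary matrices that commute up to a primitive `d`-th root of unity are simultaneously
conjugate to block clock and shift matrices. -/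
theorem exists_unitary_conj [NeZero d] {ζ : ℂ} (hζ : IsPrimitiveRoot ζ d)
    {x y : Matrix (Fin r) (Fin r) ℂ}
    (hx : x ∈ unitaryGroup (Fin r) ℂ) (hy : y ∈ unitaryGroup (Fin r) ℂ)
    (hxy : x * y = ζ • (y * x)) :
    ∃ U ∈ unitaryGroup (Fin r) ℂ, ∃ a b : Fin m → ℂ, (∀ i, ‖a i‖ = 1) ∧ (∀ i, ‖b i‖ = 1) ∧
      x * U = U * (clock ε ζ * scalar ε a) ∧ y * U = U * (shift ε * scalar ε b) := by
  have hinner : ∀ {z : Matrix (Fin r) (Fin r) ℂ}, z ∈ unitaryGroup (Fin r) ℂ →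
      ∀ u v : EuclideanSpace ℂ (Fin r),
        inner ℂ (toEuclideanLin z u) (toEuclideanLin z v) = inner ℂ u v := by
    intro z hz u v
    rw [← LinearMap.adjoint_inner_right, ← toEuclideanLin_conjTranspose_eq_adjoint,
      toLpLin_apply, toLpLin_apply, mulVec_mulVec, ← star_eq_conjTranspose,
      mem_unitaryGroup_iff'.1 hz, one_mulVec]
  have hpair : IsTwistedPair ζ (toEuclideanLin x) (toEuclideanLin y) := by
    refine ⟨hinner hx, hinner hy, fun v => ?_⟩
    rw [toLpLin_apply, toLpLin_apply, toLpLin_apply, toLpLin_apply, mulVec_mulVec, mulVec_mulVec,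
      hxy, smul_mulVec, WithLp.toLp_smul]
  obtain ⟨ι, hι, e, a, b, he, hspan⟩ := hpair.exists_family hζ _ ⊤ rfl
    (fun _ _ => Submodule.mem_top) (fun _ _ => Submodule.mem_top)
  have hcard : Fintype.card ι = m := by
    have h1 := Module.finrank_eq_card_basis (OrthonormalBasis.mk he.orthonormal hspan.ge).toBasis
    have h2 := Fintype.card_congr ε
    rw [finrank_euclideanSpace, Fintype.card_fin] at h1
    rw [Fintype.card_fin, h1] at h2
    simp only [Fintype.card_prod, Fintype.card_fin, ZMod.card] at h2
    exact Nat.eq_of_mul_eq_mul_right (NeZero.pos d) h2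
  let f : Fin m ≃ ι := (finCongr hcard.symm).trans (Fintype.equivFin ι).symm
  let U : Matrix (Fin r) (Fin r) ℂ := of fun i k => e (f (ε k).1, (ε k).2) i
  have hmul : ∀ (z : Matrix (Fin r) (Fin r) ℂ) (i k : Fin r),
      (z * U) i k = toEuclideanLin z (e (f (ε k).1, (ε k).2)) i := fun z i k => by
    rw [toLpLin_apply]; rfl
  refine ⟨U, ?_, fun i => a (f i), fun i => b (f i), fun i => he.norm_left _,
    fun i => he.norm_right _, ?_, ?_⟩
  · rw [mem_unitaryGroup_iff']
    ext k l
    have h1 : (star U * U) k l =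
        inner ℂ (e (f (ε k).1, (ε k).2)) (e (f (ε l).1, (ε l).2)) := by
      rw [EuclideanSpace.inner_eq_star_dotProduct, star_eq_conjTranspose, mul_apply, dotProduct]
      exact Finset.sum_congr rfl fun i _ => mul_comm _ _
    classical
    rw [h1, orthonormal_iff_ite.1 he.orthonormal, one_apply]
    congr 1
    rw [Prod.mk.injEq, f.injective.eq_iff, ← Prod.ext_iff, ε.injective.eq_iff]
  · ext i k
    rw [hmul, he.apply_left, clock, scalar, diagonal_mul_diagonal, mul_diagonal]
    change (a _ * _) * U i k = _
    ring
  · ext i k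
    rw [hmul, he.apply_right, mul_apply, Finset.sum_eq_single (ε.symm ((ε k).1, (ε k).2 + 1))]
    · rw [scalar, mul_diagonal, shift, of_apply]
      simp only [Equiv.apply_symm_apply, if_true, one_mul, U, of_apply]
      exact mul_comm _ _
    · intro l _ hl
      rw [scalar, mul_diagonal, shift, of_apply, if_neg, zero_mul, mul_zero]
      intro h
      exact hl (by rw [← h, Equiv.symm_apply_apply])
    · simp

/-- Block angles with sum zero; these parametrize a torus in `SU(r)`. -/
def angles (m : ℕ) : Submodule ℝ (Fin m → ℝ) :=
  LinearMap.ker (∑ i, LinearMap.proj i : (Fin m → ℝ) →ₗ[ℝ] ℝ)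

theorem mem_angles {α : Fin m → ℝ} : α ∈ angles m ↔ ∑ i, α i = 0 := by
  simp [angles]

/-- The complex numbers with the given angles. -/
noncomputable def expI (α : Fin m → ℝ) (i : Fin m) : ℂ := Complex.exp (α i * Complex.I)

theorem norm_expI (α : Fin m → ℝ) (i : Fin m) : ‖expI α i‖ = 1 :=
  Complex.norm_exp_ofReal_mul_I _

theorem _root_.SU.mk_eq_of_coe_eq_smul {x y : SU r} {z : ℂ} (h : x.1 = z • y.1) :
    (x : PU r) = (y : PU r) := by
  rw [eq_comm, QuotientGroup.eq]
  apply SU.mem_center_of_eq_smul (z := z)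
  change star y.1 * x.1 = _
  rw [h, mul_smul_comm, SU.star_mul_self]

variable [NeZero d]

theorem scalar_expI_mem {α : Fin m → ℝ} (hα : α ∈ angles m) :
    scalar ε (expI α) ∈ specialUnitaryGroup (Fin r) ℂ := by
  refine ⟨diagonal_mem_unitaryGroup fun k => norm_expI _ _, ?_⟩
  change (scalar ε (expI α)).det = 1
  rw [scalar, det_diagonal]
  unfold expI
  rw [← Complex.exp_sum, ← Finset.sum_mul, ← Complex.ofReal_sum,
    Equiv.sum_comp ε (fun p => α p.1), Fintype.sum_prod_type_right]
  simp only [mem_angles.1 hα]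
  simp

/-- The torus in `SU(r)` of matrices that are scalar on each block. -/
noncomputable def torus (α : angles m) : SU r := ⟨scalar ε (expI α.1), scalar_expI_mem ε α.2⟩

theorem continuous_torus : Continuous (torus ε : angles m → SU r) := by
  refine Continuous.subtype_mk ?_ _
  refine Continuous.matrix_diagonal (continuous_pi fun k => ?_)
  have h : Continuous fun α : angles m => α.1 (ε k).1 :=
    (continuous_apply _).comp continuous_subtype_val
  exact Complex.continuous_exp.comp
    ((Complex.continuous_ofReal.comp h).mul continuous_const)

theorem torus_zero : torus ε 0 = (1 : SU r) := by
  apply Subtype.ext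
  change scalar ε (expI 0) = 1
  rw [scalar, ← diagonal_one]
  congr 1
  funext k
  simp [expI]

/-- A unitary block scalar matrix is a multiple of an element of the torus: subtract from each
angle the average of the angles. -/
theorem exists_angles {a : Fin m → ℂ} (ha : ∀ i, ‖a i‖ = 1) :
    ∃ (α : angles m) (z : ℂ), scalar ε a = z • (torus ε α).1 := by
  rcases Nat.eq_zero_or_pos m with rfl | hm
  · refine ⟨0, 1, ?_⟩
    ext i
    exact (ε i).1.elim0
  have hm' : (m : ℝ) ≠ 0 := by positivity
  let s : ℝ := (∑ i, (a i).arg) / m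
  refine ⟨⟨fun i => (a i).arg - s, ?_⟩, Complex.exp (s * Complex.I), ?_⟩
  · rw [mem_angles, Finset.sum_sub_distrib, Finset.sum_const, Finset.card_univ, Fintype.card_fin,
      nsmul_eq_mul, mul_div_cancel₀ _ hm', sub_self]
  · change _ = _ • scalar ε (expI _)
    rw [scalar, scalar, ← diagonal_smul]
    congr 1
    funext k
    change _ = _ * Complex.exp ((((a (ε k).1).arg - s : ℝ) : ℂ) * Complex.I)
    rw [← Complex.exp_add]
    push_cast
    rw [sub_mul, add_sub_cancel]
    conv_lhs => rw [← Complex.norm_mul_exp_arg_mul_I (a (ε k).1), ha]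
    simp

/-- Two elements of `SU(r)` that commute up to a primitive `d`-th root of unity are, modulo the
center, simultaneously conjugate to torus translates of the block clock and shift matrices. -/
theorem exists_conj (hr : r ≠ 0) {ζ : ℂ} (hζ : IsPrimitiveRoot ζ d) {X₀ Y₀ : SU r} {z w : ℂ}
    (hz : z ≠ 0) (hw : w ≠ 0)
    (hX₀ : X₀.1 = z • clock ε ζ) (hY₀ : Y₀.1 = w • shift ε) {x y : SU r}
    (hxy : x.1 * y.1 = ζ • (y.1 * x.1)) :
    ∃ (g : SU r) (α β : angles m), (x : PU r) = ((g * (X₀ * torus ε α) * g⁻¹ : SU r) : PU r) ∧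
      (y : PU r) = ((g * (Y₀ * torus ε β) * g⁻¹ : SU r) : PU r) := by
  obtain ⟨U, hU, a, b, ha, hb, hxU, hyU⟩ := exists_unitary_conj ε hζ x.2.1 y.2.1 hxy
  obtain ⟨c, -, hcU⟩ := SU.exists_smul_mem hr hU
  let g : SU r := ⟨c • U, hcU⟩
  have key : ∀ {x X₀ : SU r} {M : Matrix (Fin r) (Fin r) ℂ} {a : Fin m → ℂ} {z : ℂ}, z ≠ 0 →
      (∀ i, ‖a i‖ = 1) → X₀.1 = z • M → x.1 * U = U * (M * scalar ε a) →
      ∃ α : angles m, (x : PU r) = ((g * (X₀ * torus ε α) * g⁻¹ : SU r) : PU r) := by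
    intro x X₀ M a z hz ha hX₀ hxU
    obtain ⟨α, t, ht⟩ := exists_angles ε ha
    refine ⟨α, SU.mk_eq_of_coe_eq_smul (z := z⁻¹ * t) ?_⟩
    have h1 : x.1 * g.1 = (z⁻¹ * t) • (g.1 * (X₀.1 * (torus ε α).1)) := by
      change x.1 * (c • U) = _ • ((c • U) * _)
      rw [mul_smul_comm, hxU, ht, hX₀]
      simp only [mul_smul_comm, smul_mul_assoc, smul_smul]
      congr 1
      field_simp
    change _ = _ • (g.1 * (X₀.1 * (torus ε α).1) * star g.1)
    rw [← smul_mul_assoc, ← h1, mul_assoc, SU.mul_star_self, mul_one]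
  obtain ⟨α, hα⟩ := key hz ha hX₀ hxU
  obtain ⟨β, hβ⟩ := key hw hb hY₀ hyU
  exact ⟨g, α, β, hα, hβ⟩

end Block

/-! ### Homomorphisms from `ℤ²` and commuting pairs -/

namespace HomZ

variable {G : Type} [Group G]

theorem commute_gen (f : HomZ 2 G) : Commute (f.gen 0) (f.gen 1) := by
  let F : Multiplicative (Fin 2 → ℤ) →* G := f
  exact (Commute.all (Multiplicative.ofAdd (Pi.single (0 : Fin 2) (1 : ℤ)))
    (Multiplicative.ofAdd (Pi.single (1 : Fin 2) (1 : ℤ)))).map F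

theorem ext_gen {f f' : HomZ 2 G} (h0 : f.gen 0 = f'.gen 0) (h1 : f.gen 1 = f'.gen 1) :
    f = f' := by
  have key : ∀ (F : Multiplicative (Fin 2 → ℤ) →* G) (v : Fin 2 → ℤ),
      F (Multiplicative.ofAdd v) = F (Multiplicative.ofAdd (Pi.single 0 1)) ^ v 0 *
        F (Multiplicative.ofAdd (Pi.single 1 1)) ^ v 1 := by
    intro F v
    rw [← map_zpow F, ← map_zpow F, ← map_mul F, ← ofAdd_zsmul, ← ofAdd_zsmul, ← ofAdd_add]
    congr 2
    ext i
    fin_cases i <;> simp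
  refine MonoidHom.ext (M := Multiplicative (Fin 2 → ℤ)) fun v => ?_
  exact (key f v.toAdd).trans ((congrArg₂ (fun a b => a ^ v.toAdd 0 * b ^ v.toAdd 1) h0 h1).trans
    (key f' v.toAdd).symm)

/-- The homomorphism `ℤ² → G` given by a commuting pair. -/
def ofCommute {p q : G} (h : Commute p q) : HomZ 2 G where
  toFun v := p ^ v.toAdd 0 * q ^ v.toAdd 1
  map_one' := by simp
  map_mul' v w := by
    rw [toAdd_mul, Pi.add_apply, Pi.add_apply, zpow_add, zpow_add]
    simp only [mul_assoc]
    rw [← mul_assoc (q ^ _) (p ^ _), ← (h.zpow_zpow _ _).eq, mul_assoc]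

@[simp]
theorem gen_ofCommute_zero {p q : G} (h : Commute p q) : (ofCommute h).gen 0 = p := by
  change p ^ (Pi.single 0 1 : Fin 2 → ℤ) 0 * q ^ (Pi.single 0 1 : Fin 2 → ℤ) 1 = p
  simp

@[simp]
theorem gen_ofCommute_one {p q : G} (h : Commute p q) : (ofCommute h).gen 1 = q := by
  change p ^ (Pi.single 1 1 : Fin 2 → ℤ) 0 * q ^ (Pi.single 1 1 : Fin 2 → ℤ) 1 = q
  simp

variable [TopologicalSpace G]

theorem continuous_gen (i : Fin 2) : Continuous fun f : HomZ 2 G => f.gen i :=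
  (continuous_apply (A := fun _ : Fin 2 => G) i).comp (continuous_induced_dom (f := gen))

theorem continuous_ofCommute {X : Type*} [TopologicalSpace X] {p q : X → G}
    (hp : Continuous p) (hq : Continuous q) (h : ∀ x, Commute (p x) (q x)) :
    Continuous fun x => ofCommute (h x) := by
  refine continuous_induced_rng.2 (continuous_pi fun i => ?_)
  fin_cases i
  · exact hp.congr fun x => (gen_ofCommute_zero (h x)).symm
  · exact hq.congr fun x => (gen_ofCommute_one (h x)).symm

instance [T2Space G] : T2Space (HomZ 2 G) :=
  T2Space.of_injective_continuous (f := gen)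
    (fun _ _ h => ext_gen (congrFun h 0) (congrFun h 1)) continuous_induced_dom

end HomZ

/-! ### The commutator of lifts -/

namespace PU

open Subgroup

theorem commutator_eq_of_mk_eq {G : Type} [Group G] {x x' y y' : G}
    (hx : (x : G ⧸ center G) = x') (hy : (y : G ⧸ center G) = y') : ⁅x, y⁆ = ⁅x', y'⁆ := by
  rw [QuotientGroup.eq] at hx hy
  obtain ⟨z, hz⟩ : ∃ z, z = x⁻¹ * x' := ⟨_, rfl⟩
  obtain ⟨w, hw⟩ : ∃ w, w = y⁻¹ * y' := ⟨_, rfl⟩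
  rw [← hz, mem_center_iff] at hx
  rw [← hw, mem_center_iff] at hy
  have h1 : x' = x * z := by rw [hz]; group
  have h2 : y' = y * w := by rw [hw]; group
  have hx' : ∀ g, g * z = z * g := hx
  subst h1 h2
  simp only [commutatorElement_def, mul_inv_rev]
  calc x * y * x⁻¹ * y⁻¹ = x * y * (z * z⁻¹) * x⁻¹ * (w * w⁻¹) * y⁻¹ := by group
    _ = x * (y * z) * z⁻¹ * (x⁻¹ * w) * w⁻¹ * y⁻¹ := by group
    _ = x * (z * y) * z⁻¹ * (w * x⁻¹) * w⁻¹ * y⁻¹ := by rw [hx y, hy x⁻¹]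
    _ = x * z * y * (z⁻¹ * w) * x⁻¹ * w⁻¹ * y⁻¹ := by group
    _ = x * z * y * (w * z⁻¹) * x⁻¹ * w⁻¹ * y⁻¹ := by rw [hy z⁻¹]
    _ = x * z * (y * w) * (z⁻¹ * x⁻¹) * (w⁻¹ * y⁻¹) := by group

variable {r : ℕ}

/-- The commutator of lifts to `SU(r)`; it does not depend on the lifts. -/
noncomputable def liftCommutator (p : PU r × PU r) : SU r :=
  ⁅Quotient.out p.1, Quotient.out p.2⁆

theorem liftCommutator_mk (x y : SU r) : liftCommutator ((x : PU r), (y : PU r)) = ⁅x, y⁆ :=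
  commutator_eq_of_mk_eq (Quotient.out_eq _) (Quotient.out_eq _)

theorem continuous_liftCommutator : Continuous (liftCommutator : PU r × PU r → SU r) := by
  have hq : IsOpenQuotientMap (QuotientGroup.mk : SU r → PU r) :=
    QuotientGroup.isOpenQuotientMap_mk
  rw [(hq.prodMap hq).isQuotientMap.continuous_iff]
  have : (liftCommutator : PU r × PU r → SU r) ∘
      Prod.map (QuotientGroup.mk : SU r → PU r) (QuotientGroup.mk : SU r → PU r) =
      fun p => p.1 * p.2 * p.1⁻¹ * p.2⁻¹ := by
    funext p
    exact liftCommutator_mk p.1 p.2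
  rw [this]
  fun_prop

/-- The commutator of lifts of the two generators. It takes values in the center, and its fibers
are the path components of `Hom(ℤ², PU(r))`. -/
noncomputable def comm (f : HomZ 2 (PU r)) : SU r := liftCommutator (f.gen 0, f.gen 1)

theorem comm_eq {f : HomZ 2 (PU r)} {x y : SU r} (hx : (x : PU r) = f.gen 0)
    (hy : (y : PU r) = f.gen 1) : comm f = ⁅x, y⁆ := by
  rw [comm, ← hx, ← hy, liftCommutator_mk]

theorem commute_mk_iff {x y : SU r} :
    Commute (x : PU r) (y : PU r) ↔ ⁅x, y⁆ ∈ center (SU r) := by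
  rw [← commutatorElement_eq_one_iff_commute, ← QuotientGroup.mk'_apply,
    ← QuotientGroup.mk'_apply, ← map_commutatorElement, QuotientGroup.mk'_apply,
    QuotientGroup.eq_one_iff]

theorem comm_mem_center (f : HomZ 2 (PU r)) : comm f ∈ center (SU r) := by
  obtain ⟨x, hx⟩ := QuotientGroup.mk_surjective (f.gen 0)
  obtain ⟨y, hy⟩ := QuotientGroup.mk_surjective (f.gen 1)
  rw [comm_eq hx hy, ← commute_mk_iff, hx, hy]
  exact f.commute_gen

theorem continuous_comm : Continuous (comm : HomZ 2 (PU r) → SU r) :=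
  continuous_liftCommutator.comp ((HomZ.continuous_gen 0).prodMk (HomZ.continuous_gen 1))

theorem commutator_eq_smul_one_iff {x y : SU r} {z : ℂ} :
    (⁅x, y⁆ : SU r).1 = z • (1 : Matrix (Fin r) (Fin r) ℂ) ↔
      x.1 * y.1 = z • (y.1 * x.1) := by
  have h1 : (⁅x, y⁆ : SU r).1 * (y.1 * x.1) = x.1 * y.1 :=
    congrArg Subtype.val (show ⁅x, y⁆ * (y * x) = x * y by rw [commutatorElement_def]; group)
  constructor
  · intro h
    rw [← h1, h, smul_mul_assoc, one_mul]
  · intro h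
    rw [commutatorElement_def]
    change x.1 * y.1 * star x.1 * star y.1 = _
    rw [h, smul_mul_assoc, smul_mul_assoc, mul_assoc y.1, SU.mul_star_self, mul_one,
      SU.mul_star_self]

theorem comm_eq_of_joined [NeZero r] {f f' : HomZ 2 (PU r)} (h : Joined f f') :
    comm f = comm f' := by
  have := finite_center (r := r)
  let c : HomZ 2 (PU r) → center (SU r) := fun f => ⟨comm f, comm_mem_center f⟩
  have hc : Continuous c := continuous_comm.subtype_mk _
  have hdisc : DiscreteTopology (center (SU r)) := inferInstance
  obtain ⟨γ⟩ := h
  have := (isPreconnected_range (hc.comp γ.continuous)).subsingleton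
    (Set.mem_range_self 0) (Set.mem_range_self 1)
  simpa [c] using this

/-! ### Path components -/

/-- A decomposition of the standard basis of `ℂ^r` into `m` blocks of size `d`, where `d` is the
order of the central element `ω = ζ I`, together with multiples `X₀ = z • clock`, `Y₀ = w • shift` of
the block clock and shift matrices that have determinant one. -/
structure BlockModel (ω : SU r) where
  m : ℕ
  d : ℕ
  [neZero : NeZero d]
  ε : Fin r ≃ Fin m × ZMod d
  ζ : ℂ
  isPrimitiveRoot : IsPrimitiveRoot ζ d
  coe_eq : ω.1 = ζ • (1 : Matrix (Fin r) (Fin r) ℂ)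
  X₀ : SU r
  Y₀ : SU r
  z : ℂ
  w : ℂ
  z_ne_zero : z ≠ 0
  w_ne_zero : w ≠ 0
  X₀_eq : X₀.1 = z • Block.clock ε ζ
  Y₀_eq : Y₀.1 = w • Block.shift ε

attribute [instance] BlockModel.neZero

theorem exists_blockModel [NeZero r] {ω : SU r} (hω : ω ∈ center (SU r)) :
    Nonempty (BlockModel ω) := by
  obtain ⟨ζ, hζ⟩ := SU.mem_center_iff.1 hω
  have hζr := SU.pow_eq_one_of_eq_smul hζ
  have hd : orderOf ζ ∣ r := orderOf_dvd_of_pow_eq_one hζr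
  have hd0 : NeZero (orderOf ζ) := ⟨fun h => NeZero.ne r (Nat.eq_zero_of_zero_dvd (h ▸ hd))⟩
  obtain ⟨m, hm⟩ := hd
  have hcard : Fintype.card (Fin r) = Fintype.card (Fin m × ZMod (orderOf ζ)) := by
    simp only [Fintype.card_prod, Fintype.card_fin, ZMod.card]
    rw [mul_comm]; exact hm
  let ε := Fintype.equivOfCardEq hcard
  have hζ1 : ‖ζ‖ = 1 := Complex.norm_eq_one_of_pow_eq_one hζr (NeZero.ne r)
  obtain ⟨z, hz, hX⟩ := SU.exists_smul_mem (NeZero.ne r) (Block.clock_mem ε hζ1)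
  obtain ⟨w, hw, hY⟩ := SU.exists_smul_mem (NeZero.ne r) (Block.shift_mem ε)
  exact ⟨{
    m := m
    d := orderOf ζ
    ε := ε
    ζ := ζ
    isPrimitiveRoot := IsPrimitiveRoot.orderOf ζ
    coe_eq := hζ
    X₀ := ⟨_, hX⟩
    Y₀ := ⟨_, hY⟩
    z := z
    w := w
    z_ne_zero := norm_ne_zero_iff.1 (by rw [hz]; exact one_ne_zero)
    w_ne_zero := norm_ne_zero_iff.1 (by rw [hw]; exact one_ne_zero)
    X₀_eq := rfl
    Y₀_eq := rfl }⟩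

namespace BlockModel

variable {ω : SU r} (B : BlockModel ω)

include B in
theorem mem_center : ω ∈ center (SU r) := SU.mem_center_of_eq_smul B.coe_eq

theorem m_mul_d : B.m * B.d = r := by
  have := Fintype.card_congr B.ε
  simp only [Fintype.card_prod, Fintype.card_fin, ZMod.card] at this
  exact this.symm

theorem orderOf_eq [NeZero r] : orderOf ω = B.d := by
  rw [SU.orderOf_of_eq_smul B.coe_eq, ← B.isPrimitiveRoot.eq_orderOf]

theorem commutator_torus (α β : Block.angles B.m) :
    ⁅B.X₀ * Block.torus B.ε α, B.Y₀ * Block.torus B.ε β⁆ = ω := by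
  apply Subtype.ext
  rw [B.coe_eq, commutator_eq_smul_one_iff]
  change (B.X₀.1 * Block.scalar B.ε (Block.expI α.1)) *
    (B.Y₀.1 * Block.scalar B.ε (Block.expI β.1)) = _ • (
      (B.Y₀.1 * Block.scalar B.ε (Block.expI β.1)) * (B.X₀.1 * Block.scalar B.ε (Block.expI α.1)))
  rw [B.X₀_eq, B.Y₀_eq]
  have h : Block.clock B.ε B.ζ * Block.scalar B.ε (Block.expI α.1) *
      (Block.shift B.ε * Block.scalar B.ε (Block.expI β.1)) =
      B.ζ • (Block.shift B.ε * Block.scalar B.ε (Block.expI β.1) *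
        (Block.clock B.ε B.ζ * Block.scalar B.ε (Block.expI α.1))) := by
    calc _ = Block.clock B.ε B.ζ * Block.shift B.ε *
          (Block.scalar B.ε (Block.expI α.1) * Block.scalar B.ε (Block.expI β.1)) := by
          rw [mul_assoc, ← mul_assoc (Block.scalar _ _), ← Block.shift_mul_scalar]
          simp only [mul_assoc]
      _ = B.ζ • (Block.shift B.ε * Block.clock B.ε B.ζ *
          (Block.scalar B.ε (Block.expI β.1) * Block.scalar B.ε (Block.expI α.1))) := by
          rw [Block.clock_mul_shift B.ε B.isPrimitiveRoot.pow_eq_one, smul_mul_assoc,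
            Block.scalar_mul_scalar, Block.scalar_mul_scalar]
          simp only [mul_comm]
      _ = _ := by
          rw [mul_assoc (Block.shift _), ← mul_assoc (Block.clock _ _), Block.clock_mul_scalar]
          simp only [mul_assoc]
  simp only [smul_mul_assoc, mul_smul_comm, h, smul_smul]
  congr 1
  ring

theorem commute_torus (α β : Block.angles B.m) :
    Commute ((B.X₀ * Block.torus B.ε α : SU r) : PU r)
      ((B.Y₀ * Block.torus B.ε β : SU r) : PU r) := by
  rw [commute_mk_iff, B.commutator_torus]
  exact B.mem_center

/-- The parametrization of the homomorphisms with commutator of lifts `ω`: torus translates of the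
block clock and shift matrices, conjugated by an element of `PU(r)`. -/
noncomputable def param (t : PU r × Block.angles B.m × Block.angles B.m) : HomZ 2 (PU r) :=
  HomZ.ofCommute ((B.commute_torus t.2.1 t.2.2).conj t.1)

theorem continuous_param : Continuous B.param := by
  have hmk : Continuous (QuotientGroup.mk : SU r → PU r) := QuotientGroup.continuous_mk
  have ht := Block.continuous_torus B.ε
  refine HomZ.continuous_ofCommute ?_ ?_ _
  · exact (continuous_fst.mul (hmk.comp (continuous_const.mul
      (ht.comp (continuous_fst.comp continuous_snd))))).mul continuous_fst.inv
  · exact (continuous_fst.mul (hmk.comp (continuous_const.mul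
      (ht.comp (continuous_snd.comp continuous_snd))))).mul continuous_fst.inv

theorem comm_param (t : PU r × Block.angles B.m × Block.angles B.m) : comm (B.param t) = ω := by
  obtain ⟨g, α, β⟩ := t
  obtain ⟨g, rfl⟩ := QuotientGroup.mk_surjective g
  rw [comm_eq (f := B.param _) (x := g * (B.X₀ * Block.torus B.ε α) * g⁻¹)
    (y := g * (B.Y₀ * Block.torus B.ε β) * g⁻¹) (HomZ.gen_ofCommute_zero _).symm
    (HomZ.gen_ofCommute_one _).symm, ← conjugate_commutatorElement, B.commutator_torus,
    mem_center_iff.1 B.mem_center g, mul_inv_cancel_right]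

theorem range_param [NeZero r] : Set.range B.param = {f | comm f = ω} := by
  ext f
  constructor
  · rintro ⟨t, rfl⟩
    exact B.comm_param t
  · intro (hf : comm f = ω)
    obtain ⟨x, hx⟩ := QuotientGroup.mk_surjective (f.gen 0)
    obtain ⟨y, hy⟩ := QuotientGroup.mk_surjective (f.gen 1)
    rw [comm_eq hx hy] at hf
    have hxy : x.1 * y.1 = B.ζ • (y.1 * x.1) := by
      rw [← commutator_eq_smul_one_iff, hf, B.coe_eq]
    obtain ⟨g, α, β, h1, h2⟩ := Block.exists_conj B.ε (NeZero.ne r) B.isPrimitiveRoot B.z_ne_zero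
      B.w_ne_zero B.X₀_eq B.Y₀_eq hxy
    refine ⟨(g, α, β), HomZ.ext_gen ?_ ?_⟩
    · exact (HomZ.gen_ofCommute_zero _).trans (h1.symm.trans hx)
    · exact (HomZ.gen_ofCommute_one _).trans (h2.symm.trans hy)

end BlockModel

variable [NeZero r]

/-- Every element of `PU(r)` is conjugate into a torus. -/
instance : PathConnectedSpace (PU r) := by
  have hone : ∀ p : PU r, Joined 1 p := by
    intro p
    obtain ⟨x, rfl⟩ := QuotientGroup.mk_surjective p
    obtain ⟨B⟩ := exists_blockModel (one_mem (center (SU r)))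
    have hd : B.d = 1 := by rw [← B.orderOf_eq, orderOf_one]
    have hζ : B.ζ = 1 := by simpa [hd] using B.isPrimitiveRoot.pow_eq_one
    have hX : Block.clock B.ε B.ζ = (1 : SU r).1 := by
      change Matrix.diagonal _ = (1 : Matrix (Fin r) (Fin r) ℂ)
      rw [hζ, ← Matrix.diagonal_one]
      simp only [one_pow]
    obtain ⟨g, α, -, hx, -⟩ := Block.exists_conj B.ε (NeZero.ne r) B.isPrimitiveRoot
      (X₀ := 1) (Y₀ := B.Y₀) one_ne_zero B.w_ne_zero (by rw [hX, one_smul]) B.Y₀_eq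
      (x := x) (y := 1) (by rw [hζ, one_smul]; exact (mul_one _).trans (one_mul _).symm)
    let F : Block.angles B.m → PU r := fun α => ((g * (1 * Block.torus B.ε α) * g⁻¹ : SU r) : PU r)
    have hF : Continuous F := QuotientGroup.continuous_mk.comp
      ((continuous_const.mul (continuous_const.mul (Block.continuous_torus B.ε))).mul
        continuous_const)
    have hF0 : F 0 = 1 := by
      change ((g * (1 * Block.torus B.ε 0) * g⁻¹ : SU r) : PU r) = 1
      rw [Block.torus_zero]
      simp
    rw [hx, ← hF0]
    have hj : Joined (0 : Block.angles B.m) α := PathConnectedSpace.joined _ _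
    exact hj.map hF
  exact ⟨⟨1⟩, fun p q => (hone p).symm.trans (hone q)⟩

theorem pathComponent_eq (f : HomZ 2 (PU r)) : pathComponent f = {f' | comm f' = comm f} := by
  ext f'
  constructor
  · intro h
    exact (comm_eq_of_joined h).symm
  · intro (h : comm f' = comm f)
    obtain ⟨B⟩ := exists_blockModel (comm_mem_center f)
    have hpc := isPathConnected_range B.continuous_param
    rw [B.range_param] at hpc
    exact (hpc.joinedIn f rfl f' h).joined

theorem exists_comm_eq {ω : SU r} (hω : ω ∈ center (SU r)) : ∃ f : HomZ 2 (PU r), comm f = ω := by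
  obtain ⟨B⟩ := exists_blockModel hω
  exact ⟨B.param (1, 0, 0), B.comm_param _⟩

/-- Path components correspond to central elements. -/
theorem range_pathComponent :
    Set.range (pathComponent : HomZ 2 (PU r) → Set (HomZ 2 (PU r))) =
      (fun ω => {f | comm f = ω}) '' (center (SU r) : Set (SU r)) := by
  ext S
  constructor
  · rintro ⟨f, rfl⟩
    exact ⟨comm f, comm_mem_center f, (pathComponent_eq f).symm⟩
  · rintro ⟨ω, hω, rfl⟩
    obtain ⟨f, rfl⟩ := exists_comm_eq hω
    exact ⟨f, pathComponent_eq f⟩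

theorem injOn_fiber_comm :
    Set.InjOn (fun ω => {f : HomZ 2 (PU r) | comm f = ω}) (center (SU r) : Set (SU r)) := by
  intro ω hω ω' _ h
  obtain ⟨f, hf⟩ := exists_comm_eq hω
  have hf' : f ∈ {f : HomZ 2 (PU r) | comm f = ω'} := (Set.ext_iff.1 h f).1 hf
  exact hf.symm.trans hf'

end PU

/-! ### Components whose commutator generates the center -/

namespace PU

open Subgroup

variable {r : ℕ} [NeZero r]

instance : T2Space (PU r) := by
  have := finite_center (r := r)
  have : IsClosed (center (SU r) : Set (SU r)) := Set.Finite.isClosed (Set.toFinite _)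
  infer_instance

theorem BlockModel.subsingleton_angles {ω : SU r} (B : BlockModel ω) (hω : orderOf ω = r) :
    Subsingleton (Block.angles B.m) := by
  have hm : B.m = 1 := by
    have h1 := B.m_mul_d
    rw [← B.orderOf_eq, hω] at h1
    exact (Nat.mul_eq_right (NeZero.ne r)).1 h1
  have : Subsingleton (Fin B.m) := by rw [hm]; infer_instance
  refine ⟨fun α β => Subtype.ext (funext fun i => ?_)⟩
  have h : ∀ α : Block.angles B.m, α.1 i = 0 := fun α => by
    rw [← Block.mem_angles.1 α.2, Fintype.sum_subsingleton _ i]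
  rw [h, h]

/-- `PU(r)` acts transitively by conjugation on the homomorphisms with commutator of lifts a fixed
generator of the center. -/
theorem exists_conj_of_comm_eq {ω : SU r} (hω : orderOf ω = r) {f f' : HomZ 2 (PU r)}
    (hf : comm f = ω) (hf' : comm f' = ω) :
    ∃ g : PU r, g * f.gen 0 * g⁻¹ = f'.gen 0 ∧ g * f.gen 1 * g⁻¹ = f'.gen 1 := by
  obtain ⟨B⟩ := exists_blockModel (hf ▸ comm_mem_center f : ω ∈ center (SU r))
  have := B.subsingleton_angles hω
  obtain ⟨⟨g, α, β⟩, rfl⟩ := B.range_param.ge hf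
  obtain ⟨⟨g', α', β'⟩, rfl⟩ := B.range_param.ge hf'
  obtain rfl : α' = α := Subsingleton.elim _ _
  obtain rfl : β' = β := Subsingleton.elim _ _
  refine ⟨g' * g⁻¹, ?_, ?_⟩
  · simp only [BlockModel.param, HomZ.gen_ofCommute_zero]; group
  · simp only [BlockModel.param, HomZ.gen_ofCommute_one]; group

/-- A component whose commutator of lifts generates the center is an orbit of the conjugation action
of `PU(r)`, and the stabilizers are conjugate to the clock and shift subgroup. -/
theorem nonempty_homeomorph_of_orderOf_eq {ω : SU r} (hc : ω ∈ center (SU r))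
    (hω : orderOf ω = r) :
    Nonempty ({f : HomZ 2 (PU r) | comm f = ω} ≃ₜ PU r ⧸ clockShift r) := by
  have hH := isHeisenbergPair_clock_shift (r := r)
  have hord : orderOf ⁅clock r, shift r⁆ = r := by
    rw [SU.orderOf_of_eq_smul commutator_clock_shift, ← root_isPrimitiveRoot.eq_orderOf]
  have hfin : IsOfFinOrder ⁅clock r, shift r⁆ :=
    orderOf_pos_iff.1 (by rw [hord]; exact NeZero.pos r)
  -- the class of `(clock ^ k, shift)` lies in the component, with `k` coprime to `r`
  obtain ⟨k, hk⟩ : ∃ k : ℕ, ⁅clock r, shift r⁆ ^ k = ω := by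
    have : ω ∈ zpowers ⁅clock r, shift r⁆ := hH.zpowers_commutator ▸ hc
    exact hfin.mem_powers_iff_mem_zpowers.2 this
  have hcop : k.Coprime (Nat.card (center (SU r))) := by
    rw [card_center]
    have h1 := hfin.orderOf_pow (n := k)
    rw [hk, hω, hord] at h1
    have h2 : Nat.gcd r k ∣ r := Nat.gcd_dvd_left r k
    have h3 : Nat.gcd r k = 1 := by
      obtain ⟨q, hq⟩ := h2
      have hg : 0 < Nat.gcd r k := Nat.gcd_pos_of_pos_left k (NeZero.pos r)
      have h4 : r / Nat.gcd r k = q := by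
        conv_lhs => rw [hq]
        rw [← hq]
        exact Nat.div_eq_of_eq_mul_right hg hq
      rw [h4] at h1
      rw [← h1] at hq
      exact (Nat.mul_eq_right (NeZero.ne r)).1 hq.symm
    rw [Nat.coprime_comm]
    exact h3
  have hcomm : Commute ((clock r ^ k : SU r) : PU r) (shift r : PU r) := by
    rw [commute_mk_iff, hH.commutator_pow_left, hk]
    exact hc
  let F : PU r → {f : HomZ 2 (PU r) | comm f = ω} := fun g => ⟨HomZ.ofCommute (hcomm.conj g), by
    obtain ⟨g, rfl⟩ := QuotientGroup.mk_surjective g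
    refine (comm_eq (f := HomZ.ofCommute (hcomm.conj (g : PU r)))
      (x := g * clock r ^ k * g⁻¹) (y := g * shift r * g⁻¹)
      (HomZ.gen_ofCommute_zero (hcomm.conj (g : PU r))).symm
      (HomZ.gen_ofCommute_one (hcomm.conj (g : PU r))).symm).trans ?_
    rw [← conjugate_commutatorElement, hH.commutator_pow_left, hk, mem_center_iff.1 hc g,
      mul_inv_cancel_right]⟩
  have hF0 : ∀ g, (F g).1.gen 0 = g * ((clock r ^ k : SU r) : PU r) * g⁻¹ := fun g =>
    HomZ.gen_ofCommute_zero (hcomm.conj g)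
  have hF1 : ∀ g, (F g).1.gen 1 = g * (shift r : PU r) * g⁻¹ := fun g =>
    HomZ.gen_ofCommute_one (hcomm.conj g)
  have hFc : Continuous F := Continuous.subtype_mk (HomZ.continuous_ofCommute
    ((continuous_id.mul continuous_const).mul continuous_id.inv)
    ((continuous_id.mul continuous_const).mul continuous_id.inv) fun g => hcomm.conj g) _
  have hconj : ∀ (g g' p : PU r), g * p * g⁻¹ = g' * p * g'⁻¹ ↔ Commute (g⁻¹ * g') p := by
    intro g g' p
    rw [commute_iff_eq]
    constructor
    · intro h
      calc g⁻¹ * g' * p = g⁻¹ * (g' * p * g'⁻¹) * g' := by group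
        _ = p * (g⁻¹ * g') := by rw [← h]; group
    · intro h
      calc g * p * g⁻¹ = g * (p * (g⁻¹ * g')) * g'⁻¹ := by group
        _ = g' * p * g'⁻¹ := by rw [← h]; group
  have hF : ∀ g g', F g = F g' ↔ g⁻¹ * g' ∈ clockShift r := by
    intro g g'
    change _ ↔ g⁻¹ * g' ∈ Subgroup.closure {(clock r : PU r), (shift r : PU r)}
    rw [← hH.commute_mk_pow_iff hcop, ← hconj, ← hconj, ← hF0, ← hF0, ← hF1, ← hF1]
    constructor
    · intro h; rw [h]; exact ⟨rfl, rfl⟩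
    · rintro ⟨h0, h1⟩; exact Subtype.ext (HomZ.ext_gen h0 h1)
  let E : PU r ⧸ clockShift r → {f : HomZ 2 (PU r) | comm f = ω} :=
    Quotient.lift F fun g g' h => (hF g g').2 (QuotientGroup.leftRel_apply.1 h)
  have hEc : Continuous E := hFc.quotient_lift _
  have hEb : Function.Bijective E := by
    constructor
    · intro a b hab
      obtain ⟨g, rfl⟩ := QuotientGroup.mk_surjective a
      obtain ⟨g', rfl⟩ := QuotientGroup.mk_surjective b
      exact QuotientGroup.eq.2 ((hF g g').1 hab)
    · intro f
      obtain ⟨g, h0, h1⟩ := exists_conj_of_comm_eq hω (F 1).2 f.2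
      refine ⟨(g : PU r ⧸ clockShift r), Subtype.ext (HomZ.ext_gen ?_ ?_)⟩
      · rw [← h0, hF0, show E g = F g from rfl, hF0, one_mul, inv_one, mul_one]
      · rw [← h1, hF1, show E g = F g from rfl, hF1, one_mul, inv_one, mul_one]
  have : Continuous (Equiv.ofBijective E hEb) := hEc
  exact ⟨this.homeoOfEquivCompactToT2.symm⟩

end PU

/-! ### Local injectivity -/

section LocalInjectivity

open Topology

/-- A map with injective strict derivative is injective near the point. -/
theorem HasStrictFDerivAt.exists_injOn_nhds {V W : Type*} [NormedAddCommGroup V] [NormedSpace ℝ V]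
    [FiniteDimensional ℝ V] [NormedAddCommGroup W] [NormedSpace ℝ W] {f : V → W} {f' : V →L[ℝ] W}
    {a : V} (hf : HasStrictFDerivAt f f' a) (hinj : ∀ v, f' v = 0 → v = 0) :
    ∃ s ∈ 𝓝 a, Set.InjOn f s := by
  obtain ⟨K, hK, hanti⟩ := LinearMap.exists_antilipschitzWith (f' : V →ₗ[ℝ] W)
    (LinearMap.ker_eq_bot'.2 hinj)
  obtain ⟨s, hs, happ⟩ := hf.approximates_deriv_on_nhds (c := K⁻¹ / 2) (Or.inr (by positivity))
  refine ⟨s, hs, fun x hx y hy hxy => ?_⟩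
  have h1 := happ x hx y hy
  rw [hxy, sub_self, zero_sub, norm_neg] at h1
  have h2 := hanti.le_mul_dist (x - y) 0
  simp only [ContinuousLinearMap.coe_coe, map_zero, dist_zero_right] at h2
  have hK' : (0 : ℝ) < K := hK
  have h3 : (K : ℝ) * ‖f' (x - y)‖ ≤ ‖x - y‖ / 2 := by
    calc (K : ℝ) * ‖f' (x - y)‖ ≤ K * (((K⁻¹ / 2 : NNReal) : ℝ) * ‖x - y‖) := by gcongr
      _ = ‖x - y‖ / 2 := by push_cast; field_simp
  have h4 : ‖x - y‖ = 0 := le_antisymm (by linarith) (norm_nonneg _)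
  exact sub_eq_zero.1 (norm_eq_zero.1 h4)

/-- Near a point, a continuous map into a topological group does not take two distinct values that
differ by an element of a finite set. -/
theorem exists_nhds_eq_of_inv_mul_mem_finite {X G : Type*} [TopologicalSpace X] [Group G]
    [TopologicalSpace G] [IsTopologicalGroup G] [T1Space G] {K : Set G} (hK : K.Finite)
    {p : X → G} (hp : Continuous p) (a : X) :
    ∃ s ∈ 𝓝 a, ∀ x ∈ s, ∀ y ∈ s, (p x)⁻¹ * p y ∈ K → p x = p y := by
  have hU : (K \ {1})ᶜ ∈ 𝓝 (1 : G) :=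
    (hK.subset Set.sdiff_subset).isClosed.isOpen_compl.mem_nhds (by simp)
  have hc : ContinuousAt (fun q : X × X => (p q.1)⁻¹ * p q.2) (a, a) :=
    ((hp.comp continuous_fst).inv.mul (hp.comp continuous_snd)).continuousAt
  have hpre := hc.preimage_mem_nhds (by simpa using hU)
  rw [nhds_prod_eq] at hpre
  obtain ⟨s, hs, hsub⟩ := Filter.mem_prod_same_iff.1 hpre
  refine ⟨s, hs, fun x hx y hy hxy => ?_⟩
  have h1 : (p x)⁻¹ * p y ∈ (K \ {1})ᶜ := hsub (Set.mk_mem_prod hx hy)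
  by_contra hne
  exact h1 ⟨hxy, fun h => hne (inv_mul_eq_one.1 h)⟩

end LocalInjectivity

/-! ### The dimension of the coset space -/

namespace PU

open Topology Module
open scoped Matrix.Norms.Operator

/-- The real vector space of skew-Hermitian matrices. -/
noncomputable abbrev skew (r : ℕ) : Submodule ℝ (Matrix (Fin r) (Fin r) ℂ) :=
  skewAdjoint.submodule ℝ (Matrix (Fin r) (Fin r) ℂ)

/-- The real vector space of traceless skew-Hermitian matrices. -/
noncomputable abbrev tracelessSkew (r : ℕ) : Submodule ℝ (Matrix (Fin r) (Fin r) ℂ) :=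
  skew r ⊓ LinearMap.ker (Matrix.traceLinearMap (Fin r) ℝ ℂ)

variable {r : ℕ}

theorem mem_skew {v : Matrix (Fin r) (Fin r) ℂ} : v ∈ skew r ↔ star v = -v := Iff.rfl

theorem finrank_tracelessSkew_lt [NeZero r] : finrank ℝ (tracelessSkew r) < finrank ℝ (skew r) := by
  apply Submodule.finrank_lt_finrank_of_lt
  refine lt_of_le_of_ne inf_le_left fun h => ?_
  have h1 : (Complex.I • (1 : Matrix (Fin r) (Fin r) ℂ)) ∈ skew r := by
    rw [mem_skew, star_smul, star_one]; simp
  have h2 : (Complex.I • (1 : Matrix (Fin r) (Fin r) ℂ)).trace = 0 := (h.ge h1).2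
  rw [Matrix.trace_smul, Matrix.trace_one] at h2
  simp at h2
  exact NeZero.ne r h2

/-- Twice the traceless skew-Hermitian part of a matrix. -/
noncomputable def skewPart (r : ℕ) : Matrix (Fin r) (Fin r) ℂ →ₗ[ℝ] Matrix (Fin r) (Fin r) ℂ where
  toFun A := (A - star A) - ((A - star A).trace / r) • (1 : Matrix (Fin r) (Fin r) ℂ)
  map_add' A B := by
    simp only [star_add, Matrix.trace_sub, Matrix.trace_add]
    module
  map_smul' t A := by
    ext i j
    simp only [star_smul, star_trivial, Matrix.trace_sub, Matrix.trace_smul, RingHom.id_apply,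
      Complex.real_smul, Matrix.sub_apply, Matrix.smul_apply, smul_eq_mul]
    ring

theorem skewPart_apply (A : Matrix (Fin r) (Fin r) ℂ) : skewPart r A =
    (A - star A) - ((A - star A).trace / r) • (1 : Matrix (Fin r) (Fin r) ℂ) := rfl

theorem skewPart_mem [NeZero r] (A : Matrix (Fin r) (Fin r) ℂ) : skewPart r A ∈ tracelessSkew r := by
  have hr : (r : ℂ) ≠ 0 := Nat.cast_ne_zero.2 (NeZero.ne r)
  refine ⟨mem_skew.2 ?_, ?_⟩
  · rw [skewPart_apply, star_sub, star_sub, star_star, star_smul, star_one, star_div₀,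
      Matrix.star_eq_conjTranspose, ← Matrix.trace_conjTranspose, Matrix.conjTranspose_sub,
      Matrix.conjTranspose_conjTranspose, star_natCast, Matrix.trace_sub, Matrix.trace_sub]
    module
  · change (skewPart r A).trace = 0
    rw [skewPart_apply, Matrix.trace_sub, Matrix.trace_smul, Matrix.trace_one, Fintype.card_fin,
      smul_eq_mul, div_mul_cancel₀ _ hr, sub_self]

theorem contDiff_det : ContDiff ℝ 1 (Matrix.det : Matrix (Fin r) (Fin r) ℂ → ℂ) := by
  have h : (Matrix.det : Matrix (Fin r) (Fin r) ℂ → ℂ) = fun A => ∑ σ : Equiv.Perm (Fin r),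
      ((Equiv.Perm.sign σ : ℤ) : ℂ) * ∏ i, A (σ i) i := funext fun A => Matrix.det_apply' A
  rw [h]
  refine ContDiff.sum fun σ _ => contDiff_const.mul (contDiff_prod fun i _ => ?_)
  exact (LinearMap.toContinuousLinearMap
    (Matrix.entryLinearMap ℝ ℂ (σ i) i : Matrix (Fin r) (Fin r) ℂ →ₗ[ℝ] ℂ)).contDiff

theorem fderiv_det_one_smul_one (z : ℂ) :
    fderiv ℝ (Matrix.det : Matrix (Fin r) (Fin r) ℂ → ℂ) 1 (z • 1) = r * z := by
  have h1 : HasDerivAt (fun t : ℝ => (1 : Matrix (Fin r) (Fin r) ℂ) + t • (z • 1)) (z • 1) 0 := by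
    have h := ((hasDerivAt_id (0 : ℝ)).smul_const
      (z • (1 : Matrix (Fin r) (Fin r) ℂ))).const_add 1
    rwa [one_smul] at h
  have h2 : HasFDerivAt (Matrix.det : Matrix (Fin r) (Fin r) ℂ → ℂ) (fderiv ℝ Matrix.det 1)
      ((1 : Matrix (Fin r) (Fin r) ℂ) + (0 : ℝ) • (z • 1)) := by
    rw [zero_smul, add_zero]
    exact (contDiff_det.differentiable one_ne_zero _).hasFDerivAt
  have h3 := h2.comp_hasDerivAt (0 : ℝ) h1
  have h4 : (Matrix.det ∘ fun t : ℝ => (1 : Matrix (Fin r) (Fin r) ℂ) + t • (z • 1)) =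
      fun t : ℝ => (1 + t * z) ^ r := by
    funext t
    have : (1 : Matrix (Fin r) (Fin r) ℂ) + t • (z • 1) = (1 + t * z) • 1 := by
      rw [add_smul, one_smul, mul_smul]; rfl
    rw [Function.comp_apply, this, Matrix.det_smul, Matrix.det_one, Fintype.card_fin, mul_one]
  have h5 : HasDerivAt (fun t : ℝ => (1 + (t : ℂ) * z) ^ r) (r * z) 0 := by
    have h6 : HasDerivAt (fun t : ℝ => 1 + (t : ℂ) * z) z 0 := by
      simpa using ((Complex.ofRealCLM.hasDerivAt (x := (0 : ℝ))).mul_const z).const_add 1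
    have h7 := h6.pow r
    simp only [Complex.ofReal_zero, zero_mul, add_zero, one_pow, mul_one] at h7
    exact h7
  rw [h4] at h3
  exact h3.unique h5

variable [NeZero r]

/-- Near the identity, a special unitary matrix is determined by its traceless skew-Hermitian
part: the equations `U U* = 1` and `det U = 1` fix the remaining directions to first order. -/
theorem exists_injOn_skewPart :
    ∃ s ∈ 𝓝 (1 : SU r), Set.InjOn (fun U : SU r => skewPart r U.1) s := by
  let L : Matrix (Fin r) (Fin r) ℂ →L[ℝ] Matrix (Fin r) (Fin r) ℂ :=
    LinearMap.toContinuousLinearMap (skewPart r)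
  let S : Matrix (Fin r) (Fin r) ℂ →L[ℝ] Matrix (Fin r) (Fin r) ℂ :=
    LinearMap.toContinuousLinearMap
      { toFun := star, map_add' := star_add, map_smul' := fun t A => by simp [star_smul] }
  have hS : HasStrictFDerivAt (fun A : Matrix (Fin r) (Fin r) ℂ => A * star A)
      (ContinuousLinearMap.id ℝ _ + S) 1 := by
    have := (hasStrictFDerivAt_id (𝕜 := ℝ) (1 : Matrix (Fin r) (Fin r) ℂ)).fun_mul'
      (S.hasStrictFDerivAt (x := 1))
    refine this.congr_fderiv ?_
    ext B : 1
    have : S 1 = 1 := star_one _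
    change (1 : Matrix (Fin r) (Fin r) ℂ) * S B + B * S 1 = B + S B
    rw [this, one_mul, mul_one, add_comm]
  have hΦ := (L.hasStrictFDerivAt (x := 1)).prodMk
    (hS.prodMk ((contDiff_det (r := r)).hasStrictFDerivAt (x := 1) one_ne_zero))
  obtain ⟨s, hs, hinj⟩ := hΦ.exists_injOn_nhds (by
    intro B hB
    have h1 : skewPart r B = 0 := congrArg Prod.fst hB
    have h2 : B + star B = 0 := congrArg (fun p => p.2.1) hB
    have h3 : fderiv ℝ Matrix.det 1 B = 0 := congrArg (fun p => p.2.2) hB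
    have h4 : star B = -B := eq_neg_of_add_eq_zero_right h2
    rw [skewPart_apply, h4, sub_neg_eq_add, sub_eq_zero] at h1
    have h5 : B = (((B + B).trace / r) / 2) • (1 : Matrix (Fin r) (Fin r) ℂ) := by
      rw [div_eq_inv_mul _ (2 : ℂ), mul_smul, ← h1]
      module
    rw [h5, fderiv_det_one_smul_one] at h3
    have h6 := (mul_eq_zero.1 h3).resolve_left (Nat.cast_ne_zero.2 (NeZero.ne r))
    rw [h5, h6, zero_smul])
  refine ⟨Subtype.val ⁻¹' s, continuous_subtype_val.continuousAt.preimage_mem_nhds hs, ?_⟩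
  intro U hU U' hU' h
  refine Subtype.ext (hinj hU hU' (Prod.ext h (Prod.ext ?_ ?_)))
  · exact U.mul_star_self.trans U'.mul_star_self.symm
  · exact U.det_eq_one.trans U'.det_eq_one.symm

/-- The covering `SU(r) → PU(r)/H` has finite fibers. -/
theorem finite_preimage_clockShift :
    {x : SU r | (x : PU r) ∈ clockShift r}.Finite := by
  have h1 : Finite (clockShift r) := by
    obtain ⟨e⟩ := (isHeisenbergPair_clock_shift (r := r)).nonempty_closure_mulEquiv
    rw [card_center] at e
    exact Finite.of_equiv _ e.symm.toEquiv
  have hfin := finite_center (r := r)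
  refine Set.Finite.preimage' (f := (QuotientGroup.mk : SU r → PU r)) (s := (clockShift r : Set _))
    (Set.toFinite _) fun b _ => ?_
  obtain ⟨x, rfl⟩ := QuotientGroup.mk_surjective b
  refine ((Set.toFinite (Subgroup.center (SU r) : Set (SU r))).image (x * ·)).subset ?_
  intro y hy
  exact ⟨x⁻¹ * y, QuotientGroup.eq.1 (Set.mem_preimage.1 hy).symm, mul_inv_cancel_left _ _⟩

/-- A map that is continuous and injective near `0` with values in `PU(r)/H` has a source of
dimension at most that of the Lie algebra of `SU(r)`, because `SU(r) → PU(r)/H` is a covering and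
`SU(r)` embeds near `1` into its Lie algebra. -/
theorem finrank_le_of_injOn_quotient {W : Type} [NormedAddCommGroup W] [NormedSpace ℝ W]
    [FiniteDimensional ℝ W] {c : W → PU r ⧸ clockShift r} {s : Set W} (hs : s ∈ 𝓝 0)
    (hc : ContinuousOn c s) (hinj : Set.InjOn c s) :
    finrank ℝ W ≤ finrank ℝ (tracelessSkew r) := by
  by_contra! hlt
  let q : SU r → PU r ⧸ clockShift r := fun x => ((x : PU r) : PU r ⧸ clockShift r)
  have hq : IsOpenQuotientMap q :=
    (QuotientGroup.isOpenQuotientMap_mk (N := clockShift r)).comp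
      (QuotientGroup.isOpenQuotientMap_mk (N := Subgroup.center (SU r)))
  obtain ⟨s₁, hs₁, hF⟩ := exists_injOn_skewPart (r := r)
  obtain ⟨s₂, hs₂, hK⟩ := exists_nhds_eq_of_inv_mul_mem_finite
    (finite_preimage_clockShift (r := r)) continuous_id (1 : SU r)
  obtain ⟨O, hO, hOopen, hO1⟩ := mem_nhds_iff.1 (Filter.inter_mem hs₁ hs₂)
  have hqO : Set.InjOn q O := fun x hx y hy hxy =>
    hK x (hO hx).2 y (hO hy).2 (by
      have := QuotientGroup.eq.1 hxy
      exact this)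
  let e : OpenPartialHomeomorph (SU r) (PU r ⧸ clockShift r) :=
    OpenPartialHomeomorph.ofContinuousOpen (hqO.toPartialEquiv q O) hq.continuous.continuousOn
      hq.isOpenMap hOopen
  have htarget : e.target = q '' O := rfl
  have hsource : e.source = O := rfl
  -- translate so that `0` is sent to the base point
  obtain ⟨g, hg⟩ := QuotientGroup.mk_surjective (c 0)
  let c' : W → PU r ⧸ clockShift r := fun v => g⁻¹ • c v
  have hc' : ContinuousOn c' s := (continuous_const_smul g⁻¹).comp_continuousOn hc
  have hc'inj : Set.InjOn c' s := fun v hv w hw h => hinj hv hw (smul_left_cancel _ h)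
  have hc'0 : c' 0 = q 1 := by
    simp only [c', ← hg]
    change ((g⁻¹ * g : PU r) : PU r ⧸ clockShift r) = _
    rw [inv_mul_cancel]
    rfl
  have hnhds : s ∩ c' ⁻¹' e.target ∈ 𝓝 0 := by
    refine Filter.inter_mem hs ((hc'.continuousAt hs).preimage_mem_nhds ?_)
    refine e.open_target.mem_nhds ?_
    rw [htarget, hc'0]
    exact ⟨1, hO1, rfl⟩
  let F : SU r → tracelessSkew r := fun U => ⟨skewPart r U.1, skewPart_mem U.1⟩
  have hFc : Continuous F := Continuous.subtype_mk
    ((LinearMap.toContinuousLinearMap (skewPart r)).continuous.comp continuous_subtype_val) _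
  refine not_injOn_nhds_of_finrank_lt hlt hnhds (f := fun v => F (e.symm (c' v))) ?_ ?_
  · exact hFc.comp_continuousOn (e.continuousOn_symm.comp (hc'.mono Set.inter_subset_left)
      fun v hv => hv.2)
  · intro v hv w hw h
    have h1 : e.symm (c' v) = e.symm (c' w) :=
      hF (hO (e.map_target hv.2)).1 (hO (e.map_target hw.2)).1 (congrArg Subtype.val h)
    exact hc'inj hv.1 hw.1 (e.symm.injOn hv.2 hw.2 h1)

end PU

/-! ### The dimension of the other components -/

namespace PU

open Topology Module
open scoped Matrix.Norms.Operator

variable {r : ℕ}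

theorem exp_mem_unitaryGroup {v : Matrix (Fin r) (Fin r) ℂ} (hv : v ∈ skew r) :
    NormedSpace.exp v ∈ Matrix.unitaryGroup (Fin r) ℂ := by
  rw [Matrix.mem_unitaryGroup_iff, NormedSpace.star_exp, mem_skew.1 hv,
    ← Matrix.exp_add_of_commute _ _ (Commute.neg_right (Commute.refl v)), add_neg_cancel,
    NormedSpace.exp_zero]

/-- Conjugation of a special unitary matrix by a unitary matrix. -/
noncomputable def unitaryConj (u : Matrix.unitaryGroup (Fin r) ℂ) (x : SU r) : SU r :=
  ⟨u.1 * x.1 * star u.1, mul_mem (mul_mem u.2 x.2.1) (Unitary.star_mem u.2), by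
    change (u.1 * x.1 * star u.1).det = 1
    rw [Matrix.det_mul_right_comm, (Matrix.mem_unitaryGroup_iff).1 u.2, one_mul, x.det_eq_one]⟩

theorem unitaryConj_mul (u : Matrix.unitaryGroup (Fin r) ℂ) (x y : SU r) :
    (unitaryConj u x).1 * (unitaryConj u y).1 = u.1 * (x.1 * y.1) * star u.1 := by
  change (u.1 * x.1 * star u.1) * (u.1 * y.1 * star u.1) = _
  calc _ = u.1 * x.1 * (star u.1 * u.1) * y.1 * star u.1 := by simp only [mul_assoc]
    _ = _ := by rw [(Matrix.mem_unitaryGroup_iff').1 u.2, mul_one]; simp only [mul_assoc]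

/-- The derivative of `w ↦ exp (A w) x (T w) exp (- A w)` at `0`, where `T 0 = 1`. -/
theorem exists_hasStrictFDerivAt_conj {W : Type*} [NormedAddCommGroup W] [NormedSpace ℝ W]
    (A : W →L[ℝ] Matrix (Fin r) (Fin r) ℂ) {T : W → Matrix (Fin r) (Fin r) ℂ}
    {T' : W →L[ℝ] Matrix (Fin r) (Fin r) ℂ} (hT : HasStrictFDerivAt T T' 0) (hT0 : T 0 = 1)
    (x : Matrix (Fin r) (Fin r) ℂ) :
    ∃ D : W →L[ℝ] Matrix (Fin r) (Fin r) ℂ,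
      HasStrictFDerivAt (fun w => NormedSpace.exp (A w) * (x * T w) * NormedSpace.exp (-(A w))) D 0 ∧
      ∀ w, D w = A w * x + x * T' w - x * A w := by
  have hexp : HasStrictFDerivAt (fun w => NormedSpace.exp (A w)) A 0 := by
    have h : HasStrictFDerivAt (NormedSpace.exp : Matrix (Fin r) (Fin r) ℂ → _)
        (1 : Matrix (Fin r) (Fin r) ℂ →L[ℝ] Matrix (Fin r) (Fin r) ℂ) (A 0) := by
      rw [map_zero]; exact hasStrictFDerivAt_exp_zero
    exact h.comp 0 A.hasStrictFDerivAt
  have hexp' : HasStrictFDerivAt (fun w => NormedSpace.exp (-(A w))) (-A) 0 := by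
    have h : HasStrictFDerivAt (NormedSpace.exp : Matrix (Fin r) (Fin r) ℂ → _)
        (1 : Matrix (Fin r) (Fin r) ℂ →L[ℝ] Matrix (Fin r) (Fin r) ℂ) ((-A) 0) := by
      rw [map_zero]; exact hasStrictFDerivAt_exp_zero
    exact h.comp 0 (-A).hasStrictFDerivAt
  have hxT := (hasStrictFDerivAt_const x (0 : W) (𝕜 := ℝ)).fun_mul' hT
  refine ⟨_, (hexp.fun_mul' hxT).fun_mul' hexp', fun w => ?_⟩
  change (NormedSpace.exp (A 0) * (x * T 0)) * (-(A w)) +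
    (NormedSpace.exp (A 0) * (x * T' w + 0 * T 0) + A w * (x * T 0)) *
      NormedSpace.exp (-(A 0)) = _
  rw [map_zero, neg_zero, NormedSpace.exp_zero, hT0]
  simp only [one_mul, mul_one, add_zero, mul_neg]
  abel

namespace BlockModel

variable {ω : SU r} (B : BlockModel ω)

/-- The derivative at `0` of the parametrization of the torus by angles. -/
noncomputable def torusDeriv : Block.angles B.m →L[ℝ] Matrix (Fin r) (Fin r) ℂ :=
  LinearMap.toContinuousLinearMap
    { toFun := fun s => Matrix.diagonal fun k => (s.1 (B.ε k).1 : ℂ) * Complex.I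
      map_add' := fun s t => by
        rw [Matrix.diagonal_add]
        congr 1; funext k
        simp [add_mul]
      map_smul' := fun c s => by
        rw [RingHom.id_apply, ← Matrix.diagonal_smul]
        congr 1; funext k
        simp [mul_assoc] }

theorem torusDeriv_apply (s : Block.angles B.m) : B.torusDeriv s =
    Matrix.diagonal fun k => (s.1 (B.ε k).1 : ℂ) * Complex.I := rfl

theorem hasStrictFDerivAt_torus :
    HasStrictFDerivAt (fun s : Block.angles B.m => (Block.torus B.ε s).1) B.torusDeriv 0 := by
  let ℓ : Fin r → Block.angles B.m →L[ℝ] ℂ := fun k => LinearMap.toContinuousLinearMap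
    { toFun := fun s => (s.1 (B.ε k).1 : ℂ) * Complex.I
      map_add' := fun s t => by simp [add_mul]
      map_smul' := fun c s => by simp [mul_assoc] }
  have h1 : ∀ k, HasStrictFDerivAt (fun s : Block.angles B.m => Complex.exp (ℓ k s)) (ℓ k) 0 := by
    intro k
    have := ((ℓ k).hasStrictFDerivAt (x := 0)).cexp
    rwa [map_zero, Complex.exp_zero, one_smul] at this
  have h2 := (LinearMap.toContinuousLinearMap
    (Matrix.diagonalLinearMap (Fin r) ℝ ℂ)).hasStrictFDerivAt.comp (0 : Block.angles B.m)
    (hasStrictFDerivAt_pi.2 h1)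
  exact h2

theorem torus_add (s t : Block.angles B.m) :
    Block.torus B.ε (s + t) = Block.torus B.ε s * Block.torus B.ε t := by
  apply Subtype.ext
  change Block.scalar _ _ = Block.scalar _ _ * Block.scalar _ _
  rw [Block.scalar_mul_scalar]
  congr 1
  funext i
  simp [Block.expI, add_mul, Complex.exp_add]

/-- Block angles for which the eigenvalues of the clock matrix times the torus element are
pairwise distinct. -/
theorem exists_generic_angles : ∃ a : Block.angles B.m, Function.Injective fun k : Fin r =>
    B.ζ ^ (B.ε k).2.val * Block.expI a.1 (B.ε k).1 := by
  rcases Nat.eq_zero_or_pos B.m with hm | hm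
  · refine ⟨0, fun k => ?_⟩
    have := (B.ε k).1
    rw [hm] at this
    exact this.elim0
  have hm' : (0 : ℝ) < B.m := by exact_mod_cast hm
  have hd' : (0 : ℝ) < B.d := by exact_mod_cast NeZero.pos B.d
  let c : ℝ := (∑ i : Fin B.m, ((i : ℕ) : ℝ)) / B.m
  -- neighboring angles differ by `1 / (m d)`, so all differences are less than `2π / d`
  let a : Fin B.m → ℝ := fun i => ((i : ℕ) - c) / (B.m * B.d)
  have ha : a ∈ Block.angles B.m := by
    rw [Block.mem_angles, ← Finset.sum_div, Finset.sum_sub_distrib, Finset.sum_const,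
      Finset.card_univ, Fintype.card_fin, nsmul_eq_mul, mul_div_cancel₀ _ hm'.ne', sub_self,
      zero_div]
  refine ⟨⟨a, ha⟩, fun k l hkl => ?_⟩
  simp only [Block.expI] at hkl
  have hpow := congrArg (· ^ B.d) hkl
  simp only [mul_pow, ← pow_mul, mul_comm _ B.d] at hpow
  simp only [pow_mul, B.isPrimitiveRoot.pow_eq_one, one_pow, one_mul, ← Complex.exp_nat_mul]
    at hpow
  obtain ⟨n, hn⟩ := Complex.exp_eq_exp_iff_exists_int.1 hpow
  have hreal : (B.d : ℝ) * a (B.ε k).1 = B.d * a (B.ε l).1 + n * (2 * Real.pi) := by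
    apply Complex.ofReal_injective
    apply mul_right_cancel₀ Complex.I_ne_zero
    push_cast
    linear_combination hn
  have hk := (B.ε k).1.2
  have hl := (B.ε l).1.2
  have hdiff : (((B.ε k).1 : ℕ) : ℝ) - (((B.ε l).1 : ℕ) : ℝ) = n * (2 * Real.pi) * B.m := by
    simp only [a] at hreal
    field_simp at hreal
    linarith
  have hlt : |(((B.ε k).1 : ℕ) : ℝ) - (((B.ε l).1 : ℕ) : ℝ)| < B.m := by
    have h1 : (((B.ε k).1 : ℕ) : ℝ) < B.m := by exact_mod_cast hk
    have h2 : (((B.ε l).1 : ℕ) : ℝ) < B.m := by exact_mod_cast hl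
    have h3 : (0 : ℝ) ≤ (((B.ε k).1 : ℕ) : ℝ) := Nat.cast_nonneg _
    have h4 : (0 : ℝ) ≤ (((B.ε l).1 : ℕ) : ℝ) := Nat.cast_nonneg _
    rw [abs_lt]; constructor <;> linarith
  have hn0 : n = 0 := by
    by_contra hn0
    have h1 : (1 : ℝ) ≤ |(n : ℝ)| := by exact_mod_cast Int.one_le_abs hn0
    rw [hdiff, abs_mul, abs_mul, abs_of_pos hm', abs_of_pos Real.two_pi_pos] at hlt
    nlinarith [Real.pi_gt_three, mul_pos Real.two_pi_pos hm']
  have h1 : (B.ε k).1 = (B.ε l).1 := by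
    rw [hn0, Int.cast_zero, zero_mul, zero_mul, sub_eq_zero] at hdiff
    exact Fin.ext (by exact_mod_cast hdiff)
  rw [h1] at hkl
  have h2 := mul_right_cancel₀ (Complex.exp_ne_zero _) hkl
  have h3 := ZMod.val_injective _
    (B.isPrimitiveRoot.pow_inj (ZMod.val_lt _) (ZMod.val_lt _) h2)
  exact B.ε.injective (Prod.ext h1 h3)

/-- The imaginary parts of the traces of the diagonal blocks. -/
noncomputable def blockTrace : Matrix (Fin r) (Fin r) ℂ →ₗ[ℝ] (Fin B.m → ℝ) where
  toFun v i := ∑ j, (v (B.ε.symm (i, j)) (B.ε.symm (i, j))).im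
  map_add' v w := by
    funext i
    simp [Finset.sum_add_distrib]
  map_smul' c v := by
    funext i
    simp [Finset.mul_sum]

/-- The skew-Hermitian matrices whose diagonal blocks have trace zero; a complement of the
Lie algebra of the centralizer of a generic pair. -/
noncomputable abbrev transverse : Submodule ℝ (skew r) :=
  LinearMap.ker (B.blockTrace ∘ₗ (skew r).subtype)

/-- The transverse directions have codimension at most the number of blocks. -/
theorem finrank_skew_le : finrank ℝ (skew r) ≤ finrank ℝ B.transverse + B.m := by
  have h1 := LinearMap.finrank_range_add_finrank_ker (B.blockTrace ∘ₗ (skew r).subtype)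
  have h2 := Submodule.finrank_le (LinearMap.range (B.blockTrace ∘ₗ (skew r).subtype))
  rw [finrank_fin_fun] at h2
  change _ ≤ finrank ℝ (LinearMap.ker (B.blockTrace ∘ₗ (skew r).subtype)) + B.m
  omega

theorem le_finrank_angles (m : ℕ) : m ≤ finrank ℝ (Block.angles m) + 1 := by
  have h1 := LinearMap.finrank_range_add_finrank_ker
    (∑ i, LinearMap.proj i : (Fin m → ℝ) →ₗ[ℝ] ℝ)
  have h2 := Submodule.finrank_le
    (LinearMap.range (∑ i, LinearMap.proj i : (Fin m → ℝ) →ₗ[ℝ] ℝ))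
  rw [finrank_fin_fun] at h1
  rw [finrank_self] at h2
  change m ≤ finrank ℝ (LinearMap.ker (∑ i, LinearMap.proj i : (Fin m → ℝ) →ₗ[ℝ] ℝ)) + 1
  omega

/-- At a generic pair, the conjugation directions transverse to the centralizer and the torus
directions are linearly independent. -/
theorem eq_zero_of_deriv_eq_zero {a : Block.angles B.m} (ha : Function.Injective fun k : Fin r =>
      B.ζ ^ (B.ε k).2.val * Block.expI a.1 (B.ε k).1)
    {v : skew r} (hv : v ∈ B.transverse) {s t : Block.angles B.m}
    (h1 : v.1 * (B.X₀ * Block.torus B.ε a).1 + (B.X₀ * Block.torus B.ε a).1 * B.torusDeriv s -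
      (B.X₀ * Block.torus B.ε a).1 * v.1 = 0)
    (h2 : v.1 * B.Y₀.1 + B.Y₀.1 * B.torusDeriv t - B.Y₀.1 * v.1 = 0) :
    v = 0 ∧ s = 0 ∧ t = 0 := by
  obtain ⟨v, hvs⟩ := v
  simp only at h1 h2
  let p : Fin r → ℂ := fun k => B.ζ ^ (B.ε k).2.val * Block.expI a.1 (B.ε k).1
  have hp0 : ∀ k, p k ≠ 0 := fun k => mul_ne_zero
    (pow_ne_zero _ (B.isPrimitiveRoot.ne_zero (NeZero.ne B.d))) (Complex.exp_ne_zero _)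
  have hx : (B.X₀ * Block.torus B.ε a).1 = B.z • Matrix.diagonal p := by
    change B.X₀.1 * Block.scalar B.ε (Block.expI a.1) = _
    rw [B.X₀_eq, Block.clock, Block.scalar, smul_mul_assoc, Matrix.diagonal_mul_diagonal]
  rw [hx] at h1
  have hentry : ∀ k l, v k l * p l + p k * (B.torusDeriv s) k l - p k * v k l = 0 := by
    intro k l
    have h := congrFun (congrFun h1 k) l
    rw [mul_smul_comm, smul_mul_assoc, smul_mul_assoc, ← smul_add, ← smul_sub,
      Matrix.smul_apply, Matrix.sub_apply, Matrix.add_apply, Matrix.mul_diagonal,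
      Matrix.diagonal_mul, Matrix.diagonal_mul, smul_eq_mul] at h
    exact (mul_eq_zero.1 h).resolve_left B.z_ne_zero
  have hs : s = 0 := by
    apply Subtype.ext
    funext i
    have h := hentry (B.ε.symm (i, 0)) (B.ε.symm (i, 0))
    rw [torusDeriv_apply, Matrix.diagonal_apply_eq, mul_comm (p _) (v _ _), add_sub_cancel_left]
      at h
    have h' := (mul_eq_zero.1 h).resolve_left (hp0 _)
    simpa using h'
  have hoff : ∀ k l, k ≠ l → v k l = 0 := by
    intro k l hkl
    have h := hentry k l
    rw [hs, map_zero, Matrix.zero_apply, mul_zero, add_zero, mul_comm (p k), ← mul_sub] at h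
    exact (mul_eq_zero.1 h).resolve_right (sub_ne_zero.2 fun h => hkl (ha h).symm)
  -- the diagonal of `v` changes by a constant amount from one position in a block to the next
  have hstep : ∀ i j, v (B.ε.symm (i, j + 1)) (B.ε.symm (i, j + 1)) =
      v (B.ε.symm (i, j)) (B.ε.symm (i, j)) - (t.1 i : ℂ) * Complex.I := by
    intro i j
    have h := congrFun (congrFun h2 (B.ε.symm (i, j + 1))) (B.ε.symm (i, j))
    have hvd : v = Matrix.diagonal fun k => v k k := by
      ext k l
      rcases eq_or_ne k l with rfl | hkl
      · simp
      · rw [hoff k l hkl, Matrix.diagonal_apply_ne _ hkl]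
    rw [B.Y₀_eq, hvd, torusDeriv_apply, mul_smul_comm, smul_mul_assoc, smul_mul_assoc,
      ← smul_add, ← smul_sub, Matrix.smul_apply, Matrix.sub_apply, Matrix.add_apply,
      Matrix.mul_diagonal, Matrix.diagonal_mul, Matrix.mul_diagonal, Block.shift,
      Matrix.of_apply, smul_eq_mul] at h
    simp only [Equiv.apply_symm_apply, if_true, one_mul, mul_one] at h
    have h' := (mul_eq_zero.1 h).resolve_left B.w_ne_zero
    linear_combination h'
  have ht : t = 0 := by
    apply Subtype.ext
    funext i
    have hsum := Equiv.sum_comp (Equiv.addRight (1 : ZMod B.d))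
      fun j => v (B.ε.symm (i, j)) (B.ε.symm (i, j))
    simp only [Equiv.coe_addRight, hstep, Finset.sum_sub_distrib] at hsum
    have hz : (B.d : ℂ) * ((t.1 i : ℂ) * Complex.I) = 0 := by
      rw [Finset.sum_const, Finset.card_univ, ZMod.card, nsmul_eq_mul] at hsum
      linear_combination -hsum
    simpa [NeZero.ne B.d] using hz
  refine ⟨?_, hs, ht⟩
  have hconst : ∀ i j, v (B.ε.symm (i, j)) (B.ε.symm (i, j)) =
      v (B.ε.symm (i, 0)) (B.ε.symm (i, 0)) := by
    intro i j
    obtain ⟨n, rfl⟩ := ZMod.natCast_zmod_surjective j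
    induction n with
    | zero => simp
    | succ n ih =>
      rw [Nat.cast_succ, hstep, ih, ht]
      simp
  have hdiag0 : ∀ i, v (B.ε.symm (i, 0)) (B.ε.symm (i, 0)) = 0 := by
    intro i
    apply Complex.ext
    · have h := congrFun (congrFun (mem_skew.1 hvs) (B.ε.symm (i, 0))) (B.ε.symm (i, 0))
      have h' := congrArg Complex.re h
      rw [Matrix.star_apply, Matrix.neg_apply, Complex.star_def, Complex.conj_re,
        Complex.neg_re] at h'
      rw [Complex.zero_re]
      linarith
    · have h : ∑ j, (v (B.ε.symm (i, j)) (B.ε.symm (i, j))).im = 0 :=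
        congrFun (LinearMap.mem_ker.1 hv) i
      simp only [hconst i, Finset.sum_const, Finset.card_univ, ZMod.card, nsmul_eq_mul] at h
      exact (mul_eq_zero.1 h).resolve_left (Nat.cast_ne_zero.2 (NeZero.ne B.d))
  apply Subtype.ext
  ext k l
  rcases eq_or_ne k l with rfl | hkl
  · have := hconst (B.ε k).1 (B.ε k).2
    rw [hdiag0, Prod.mk.eta, Equiv.symm_apply_apply] at this
    exact this
  · exact hoff k l hkl

/-- Unitary conjugates of torus translates of the block clock and shift matrices have commutator
`ω`. -/
theorem commutator_unitaryConj (u : Matrix.unitaryGroup (Fin r) ℂ) (s t : Block.angles B.m) :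
    ⁅unitaryConj u (B.X₀ * Block.torus B.ε s), unitaryConj u (B.Y₀ * Block.torus B.ε t)⁆ = ω := by
  apply Subtype.ext
  rw [B.coe_eq, commutator_eq_smul_one_iff, unitaryConj_mul, unitaryConj_mul]
  have h' := congrArg Subtype.val (B.commutator_torus s t)
  rw [B.coe_eq, commutator_eq_smul_one_iff] at h'
  rw [h', mul_smul_comm, smul_mul_assoc]

theorem hasStrictFDerivAt_torus_comp {W : Type*} [NormedAddCommGroup W] [NormedSpace ℝ W]
    (P : W →L[ℝ] Block.angles B.m) :
    HasStrictFDerivAt (fun w => (Block.torus B.ε (P w)).1) (B.torusDeriv.comp P) 0 := by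
  have h : HasStrictFDerivAt (fun s : Block.angles B.m => (Block.torus B.ε s).1) B.torusDeriv
      (P 0) := by
    rw [map_zero]; exact B.hasStrictFDerivAt_torus
  exact h.comp 0 P.hasStrictFDerivAt

section

variable {W : Type*} [NormedAddCommGroup W] [NormedSpace ℝ W]
  (A : W →L[ℝ] Matrix (Fin r) (Fin r) ℂ)

/-- The family of conjugates of `x * torus (P w)` by `exp (A w)`. -/
noncomputable def conjFamily (hA : ∀ w, A w ∈ skew r) (x : SU r)
    (P : W →L[ℝ] Block.angles B.m) (w : W) : SU r :=
  unitaryConj ⟨NormedSpace.exp (A w), exp_mem_unitaryGroup (hA w)⟩ (x * Block.torus B.ε (P w))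

theorem conjFamily_coe (hA : ∀ w, A w ∈ skew r) (x : SU r)
    (P : W →L[ℝ] Block.angles B.m) (w : W) :
    (B.conjFamily A hA x P w).1 =
      NormedSpace.exp (A w) * (x.1 * (Block.torus B.ε (P w)).1) * NormedSpace.exp (-(A w)) := by
  have hstar : star (NormedSpace.exp (A w)) = NormedSpace.exp (-(A w)) := by
    rw [NormedSpace.star_exp, mem_skew.1 (hA w)]
  rw [← hstar]
  rfl

theorem continuous_conjFamily (hA : ∀ w, A w ∈ skew r) (x : SU r)
    (P : W →L[ℝ] Block.angles B.m) :
    Continuous (B.conjFamily A hA x P) := by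
  have hu : Continuous fun w : W => NormedSpace.exp (A w) :=
    NormedSpace.exp_continuous.comp A.continuous
  have hk : Continuous fun w : W => (x * Block.torus B.ε (P w) : SU r) :=
    continuous_const.mul ((Block.continuous_torus B.ε).comp P.continuous)
  exact Continuous.subtype_mk ((hu.mul (continuous_subtype_val.comp hk)).mul hu.star) _

/-- If the directions of conjugation are transverse to the centralizer of a generic pair, then the
resulting family of commuting pairs is injective near the generic pair. -/
theorem exists_injOn_fiber_of_linear [NeZero r] [FiniteDimensional ℝ W] (hA : ∀ w, A w ∈ skew r)
    (hA' : ∀ w, B.blockTrace (A w) = 0) (P₁ P₂ : W →L[ℝ] Block.angles B.m)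
    (hinj : ∀ w, A w = 0 → P₁ w = 0 → P₂ w = 0 → w = 0) :
    ∃ c : W → {f : HomZ 2 (PU r) | comm f = ω}, ∃ s ∈ 𝓝 0, Continuous c ∧ Set.InjOn c s := by
  obtain ⟨a, ha⟩ := B.exists_generic_angles
  let x := B.conjFamily A hA (B.X₀ * Block.torus B.ε a) P₁
  let y := B.conjFamily A hA B.Y₀ P₂
  have hxc : Continuous x := B.continuous_conjFamily A hA _ _
  have hyc : Continuous y := B.continuous_conjFamily A hA _ _
  have hcomm : ∀ w, ⁅x w, y w⁆ = ω := by
    intro w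
    have h := B.commutator_unitaryConj ⟨NormedSpace.exp (A w), exp_mem_unitaryGroup (hA w)⟩
      (a + P₁ w) (P₂ w)
    rwa [B.torus_add, ← mul_assoc] at h
  have hcommute : ∀ w, Commute (x w : PU r) (y w : PU r) := fun w => by
    rw [commute_mk_iff, hcomm]
    exact B.mem_center
  have := finite_center (r := r)
  have hfin : (Subgroup.center (SU r) : Set (SU r)).Finite := Set.toFinite _
  obtain ⟨s₁, hs₁, hx₁⟩ := exists_nhds_eq_of_inv_mul_mem_finite hfin hxc 0
  obtain ⟨s₂, hs₂, hy₂⟩ := exists_nhds_eq_of_inv_mul_mem_finite hfin hyc 0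
  have hT0 : ∀ P : W →L[ℝ] Block.angles B.m, (Block.torus B.ε (P 0)).1 = 1 := fun P => by
    rw [map_zero, Block.torus_zero]; rfl
  obtain ⟨D₁, hD₁, hD₁a⟩ := exists_hasStrictFDerivAt_conj A (B.hasStrictFDerivAt_torus_comp P₁)
    (hT0 P₁) (B.X₀ * Block.torus B.ε a).1
  obtain ⟨D₂, hD₂, hD₂a⟩ := exists_hasStrictFDerivAt_conj A (B.hasStrictFDerivAt_torus_comp P₂)
    (hT0 P₂) B.Y₀.1
  obtain ⟨s₃, hs₃, hinj₃⟩ := (hD₁.prodMk hD₂).exists_injOn_nhds (by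
    intro w hw
    have h := B.eq_zero_of_deriv_eq_zero ha (v := ⟨A w, hA w⟩) (s := P₁ w) (t := P₂ w)
      (LinearMap.mem_ker.2 (hA' w)) ((hD₁a w).symm.trans (congrArg Prod.fst hw))
      ((hD₂a w).symm.trans (congrArg Prod.snd hw))
    exact hinj w (congrArg Subtype.val h.1) h.2.1 h.2.2)
  refine ⟨fun w => ⟨HomZ.ofCommute (hcommute w), (comm_eq (HomZ.gen_ofCommute_zero _).symm
      (HomZ.gen_ofCommute_one _).symm).trans (hcomm w)⟩, s₁ ∩ s₂ ∩ s₃,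
    Filter.inter_mem (Filter.inter_mem hs₁ hs₂) hs₃,
    Continuous.subtype_mk (HomZ.continuous_ofCommute (QuotientGroup.continuous_mk.comp hxc)
      (QuotientGroup.continuous_mk.comp hyc) hcommute) _, ?_⟩
  rintro w ⟨⟨hw₁, hw₂⟩, hw₃⟩ w' ⟨⟨hw'₁, hw'₂⟩, hw'₃⟩ hww
  have hg := congrArg Subtype.val hww
  have h0 : (x w : PU r) = (x w' : PU r) := by
    simpa using congrArg (fun f => HomZ.gen f 0) hg
  have h1 : (y w : PU r) = (y w' : PU r) := by
    simpa using congrArg (fun f => HomZ.gen f 1) hg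
  have hx := congrArg Subtype.val (hx₁ w hw₁ w' hw'₁ (QuotientGroup.eq.1 h0))
  have hy := congrArg Subtype.val (hy₂ w hw₂ w' hw'₂ (QuotientGroup.eq.1 h1))
  rw [B.conjFamily_coe, B.conjFamily_coe] at hx hy
  exact hinj₃ hw₃ hw'₃ (Prod.ext hx hy)

end

/-- A component contains an injective continuous image of a neighborhood of `0` in the space of
transverse directions and two copies of the torus directions. -/
theorem exists_injOn_fiber [NeZero r] :
    ∃ c : EuclideanSpace ℝ (Fin (finrank ℝ B.transverse)) × Block.angles B.m × Block.angles B.m →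
        {f : HomZ 2 (PU r) | comm f = ω},
      ∃ s ∈ 𝓝 0, Continuous c ∧ Set.InjOn c s := by
  have hfree : Module.Free ℝ B.transverse := Module.Free.of_divisionRing ℝ B.transverse
  let e : EuclideanSpace ℝ (Fin (finrank ℝ B.transverse)) ≃ₗ[ℝ] B.transverse :=
    LinearEquiv.ofFinrankEq _ _ finrank_euclideanSpace_fin
  refine B.exists_injOn_fiber_of_linear (LinearMap.toContinuousLinearMap
    ((skew r).subtype ∘ₗ B.transverse.subtype ∘ₗ e.toLinearMap ∘ₗ LinearMap.fst ℝ _ _))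
    (fun w => (e w.1).1.2) (fun w => LinearMap.mem_ker.1 (e w.1).2)
    ((ContinuousLinearMap.fst ℝ _ _).comp (ContinuousLinearMap.snd ℝ _ _))
    ((ContinuousLinearMap.snd ℝ _ _).comp (ContinuousLinearMap.snd ℝ _ _)) ?_
  rintro ⟨v, s, t⟩ hv hs ht
  exact Prod.ext (e.map_eq_zero_iff.1 (Subtype.ext (Subtype.ext hv))) (Prod.ext hs ht)

end BlockModel

end PU

namespace PU

open Topology Module

variable {r : ℕ} [NeZero r]

/-- A component whose commutator does not generate the center contains a cell of dimension larger
than that of `PU(r)`. -/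
theorem not_nonempty_homeomorph {ω : SU r} (hc : ω ∈ Subgroup.center (SU r)) (hω : orderOf ω ≠ r) :
    ¬ Nonempty ({f : HomZ 2 (PU r) | comm f = ω} ≃ₜ PU r ⧸ clockShift r) := by
  rintro ⟨e⟩
  obtain ⟨B⟩ := exists_blockModel hc
  have hm : 2 ≤ B.m := by
    have h1 := B.m_mul_d
    have h2 := B.orderOf_eq
    have hr := NeZero.pos r
    by_contra! h
    interval_cases hB : B.m
    · omega
    · exact hω (h2.trans (by omega))
  obtain ⟨c, s, hs, hcc, hinj⟩ := B.exists_injOn_fiber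
  have h1 := finrank_le_of_injOn_quotient (c := fun w => e (c w)) hs
    (e.continuous.comp hcc).continuousOn (e.injective.comp_injOn hinj)
  have h2 := finrank_tracelessSkew_lt (r := r)
  have h3 := B.finrank_skew_le
  have h4 := BlockModel.le_finrank_angles B.m
  rw [finrank_prod, finrank_prod, finrank_euclideanSpace_fin] at h1
  omega

theorem ncard_center_orderOf_eq :
    {ω : SU r | ω ∈ Subgroup.center (SU r) ∧ orderOf ω = r}.ncard = φ r := by
  have := finite_center (r := r)
  have := isHeisenbergPair_clock_shift (r := r)
  have hcyc : IsCyclic (Subgroup.center (SU r)) := by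
    rw [← this.zpowers_commutator]
    infer_instance
  have := Fintype.ofFinite (Subgroup.center (SU r))
  have hcard : Fintype.card (Subgroup.center (SU r)) = r := by
    rw [← Nat.card_eq_fintype_card, card_center]
  have h := IsCyclic.card_orderOf_eq_totient (α := Subgroup.center (SU r)) (d := r)
    (by rw [hcard])
  rw [← h, ← Set.ncard_coe_finset]
  refine Eq.trans (congrArg Set.ncard (Set.ext fun ω => ?_))
    (Set.ncard_image_of_injective _ Subtype.val_injective)
  simp [and_comm]

end PU

theorem mainTheorem4 (r : ℕ) (hr : 1 ≤ r) :
    (Set.range (pathComponent : HomZ 2 (PU r) → Set (HomZ 2 (PU r)))).ncard = r ∧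
    Nonempty (PU.clockShift r ≃* Multiplicative (ZMod r × ZMod r)) ∧
    {S : Set (HomZ 2 (PU r)) |
        S ∈ Set.range pathComponent ∧ Nonempty (S ≃ₜ PU r ⧸ PU.clockShift r)}.ncard = φ r ∧
    ∀ (f : HomZ 2 (PU r)) (x y : SU r),
      (QuotientGroup.mk x : PU r) = f.gen 0 → (QuotientGroup.mk y : PU r) = f.gen 1 →
        (Nonempty (pathComponent f ≃ₜ PU r ⧸ PU.clockShift r) ↔
          Subgroup.zpowers ⁅x, y⁆ = Subgroup.center (SU r)) := by
  have : NeZero r := ⟨by omega⟩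
  have hiff : ∀ ω ∈ Subgroup.center (SU r),
      (Nonempty ({f : HomZ 2 (PU r) | PU.comm f = ω} ≃ₜ PU r ⧸ PU.clockShift r) ↔
        orderOf ω = r) := fun ω hω =>
    ⟨fun h => by_contra fun hne => PU.not_nonempty_homeomorph hω hne h,
      PU.nonempty_homeomorph_of_orderOf_eq hω⟩
  refine ⟨?_, ?_, ?_, ?_⟩
  · rw [PU.range_pathComponent, PU.injOn_fiber_comm.ncard_image, ← Nat.card_coe_set_eq]
    exact PU.card_center
  · have h := PU.isHeisenbergPair_clock_shift (r := r).nonempty_closure_mulEquiv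
    rwa [PU.card_center] at h
  · rw [← PU.ncard_center_orderOf_eq, ← Set.InjOn.ncard_image
      (PU.injOn_fiber_comm.mono fun ω h => h.1), PU.range_pathComponent]
    congr 1
    ext S
    constructor
    · rintro ⟨⟨ω, hω, rfl⟩, h⟩
      exact ⟨ω, ⟨hω, (hiff ω hω).1 h⟩, rfl⟩
    · rintro ⟨ω, ⟨hω, h⟩, rfl⟩
      exact ⟨⟨ω, hω, rfl⟩, (hiff ω hω).2 h⟩
  · intro f x y hx hy
    rw [PU.pathComponent_eq, hiff _ (PU.comm_mem_center f), ← PU.comm_eq hx hy,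
      PU.zpowers_eq_center_iff (PU.comm_mem_center f)]
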